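/- Let $K$ be a field of characteristic zero or $K=\mathbb{Z}$. Let $n,m\ge 0$ be integers, and let $\mathcal F$ be the field of fractions of $K[x_1,\dots,x_{n+m}]$, where $x_1,\dots,x_{n+m}$ are algebraically independent over $K$. Write $\mathbf x=(x_1,\dots,x_n)$ for the exchangeable variables and $\mathbf y=(x_{n+1},\dots,x_{n+m})$ for the frozen variables. Let $B=(b_{jk})$ be an $(n+m)\times n$ integer matrix whose principal part (its first $n$ rows) is skew-symmetrizable, that is, there are positive integers $d_1,\dots,d_n$ with $d_jb_{jk}=-d_kb_{kj}$ for all $j,k\in[1,n]$. Such a triple $\Sigma=(\mathbf x,\mathbf y,B)$ is called a seed. If $K$ is a field, assume that no column of $B$ is zero, i.e. that the ice quiver of $B$ has no isolated exchangeable vertex. For $i\in[1,n]$, the mutation $\mu_i(\Sigma)=(\mathbf x_i,\mathbf y,B_i)$ is obtained by replacing $x_i$ by $$x_i'=\frac1{x_i}\Bigl(\prod_{b_{ki}>0}x_k^{b_{ki}}+\prod_{b_{ki}<0}x_k^{-b_{ki}}\Bigr)\in\mathcal F$$ and $B$ by $B_i=(b'_{jk})$, where $b'_{jk}=-b_{jk}$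 if $j=i$ or $k=i$, and $b'_{jk}=b_{jk}+\tfrac12(|b_{ji}|b_{ik}+b_{ji}|b_{ik}|)$ otherwise. Let $f_i=x_ix_i'$ be the exchange polynomial. For a seed $(\mathbf z,\mathbf y,C)$ let $\mathcal L_{\mathbf z}=K[u^{\pm1}\mid u\in\mathbf z\cup\mathbf y]\subseteq\mathcal F$, and let $$\mathcal U=\mathcal U(\Sigma)=\bigcap_{\mathbf z\sim\mathbf x}\mathcal L_{\mathbf z}$$ be the upper cluster algebra of $\Sigma$, where the intersection runs over all seeds obtained from $\Sigma$ by finitely many mutations. Then $x_1,\dots,x_n\in\mathcal U$, and for every $i\in[1,n]$ there is a prime ideal $\mathfrak p$ of $\mathcal U$ of height $1$ such that the localization $\mathcal U_{\mathfrak p}$ is a discrete valuation ring and its normalized valuation $v_{\mathfrak p}$ satisfies $$v_{\mathfrak p}(x_i)=1\qquad\text{and}\qquad v_{\mathfrak p}(x_j)=0\quad\text{for every } j\in[1,n]\setminus\{i\}.$$ Moreover, $\mathfrak p$ can be chosen of the form $\mathfrak p=\mathcal U\cap q\,\mathcal L_{\mathbf x_i}$, where $q$ is a prime element of $\mathcal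 L_{\mathbf x_i}$ that divides $f_i$ with multiplicity exactly one. -/

import Mathlib

/-- The data `(x, y, B)` of a seed with `n` exchangeable and `m` frozen variables in a field `F`.
The variables are indexed by `Fin n ⊕ Fin m`: `var (Sum.inl j)` is the `j`-th exchangeable variable,
`var (Sum.inr a)` is the `a`-th frozen variable. -/
structure SeedTriple (F : Type*) (n m : ℕ) where
  /-- the extended cluster -/
  var : Fin n ⊕ Fin m → F
  /-- the `(n + m) × n` integer matrix -/
  mat : Matrix (Fin n ⊕ Fin m) (Fin n) ℤ

/-- An `(n + m) × n` integer matrix is an exchange matrix if its principal part (the first `n` rows)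
is skew-symmetrizable: `D * B` is skew-symmetric for some diagonal matrix `D` with positive integer
diagonal entries. -/
def IsExchangeMatrix {n m : ℕ} (B : Matrix (Fin n ⊕ Fin m) (Fin n) ℤ) : Prop :=
  ∃ d : Fin n → ℕ, (∀ j, 0 < d j) ∧
    ∀ j k, (d j : ℤ) * B (Sum.inl j) k = -((d k : ℤ) * B (Sum.inl k) j)

/-- The number of arrows from one vertex to another in the ice quiver `Γ(B)` of an exchange
matrix `B`: if `b_{uj} > 0`, there are `b_{uj}` arrows `u → j`; if moreover `a` is frozen and
`b_{aj} < 0`, there are `-b_{aj}` arrows `j → a`. -/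
def iceQuiverArrows {n m : ℕ} (B : Matrix (Fin n ⊕ Fin m) (Fin n) ℤ) :
    Fin n ⊕ Fin m → Fin n ⊕ Fin m → ℕ
  | u, Sum.inl j => (B u j).toNat
  | Sum.inl j, Sum.inr a => (-B (Sum.inr a) j).toNat
  | Sum.inr _, Sum.inr _ => 0

/-- A vertex of the ice quiver `Γ(B)` is isolated if no arrow starts or ends there. -/
def IsIsolatedVertex {n m : ℕ} (B : Matrix (Fin n ⊕ Fin m) (Fin n) ℤ) (v : Fin n ⊕ Fin m) : Prop :=
  ∀ w, iceQuiverArrows B v w = 0 ∧ iceQuiverArrows B w v = 0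

namespace SeedTriple

/-- A triple is a seed over `K` with ambient field `F` if its variables are algebraically independent
over `K`, they generate `F` as a field over (the fraction field of) `K`, and its matrix is an exchange
matrix. -/
structure IsSeed (K : Type*) {F : Type*} [CommRing K] [Field F] [Algebra K F] {n m : ℕ}
    (S : SeedTriple F n m) : Prop where
  algebraicIndependent : AlgebraicIndependent K S.var
  generates : Subfield.closure (Set.range (algebraMap K F) ∪ Set.range S.var) = ⊤
  isExchangeMatrix : IsExchangeMatrix S.mat

variable {F : Type*} [Field F] {n m : ℕ}

/-- The variable `x_i'` with
`x_i' = x_i⁻¹ (∏_{b_{ki} > 0} x_k ^ b_{ki} + ∏_{b_{ki} < 0} x_k ^ (-b_{ki}))`.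
The factors with the other sign have exponent `0`. -/
noncomputable def newVar (S : SeedTriple F n m) (i : Fin n) : F :=
  (S.var (Sum.inl i))⁻¹ *
    ((∏ k, S.var k ^ (S.mat k i).toNat) + ∏ k, S.var k ^ (-S.mat k i).toNat)

/-- The mutation of a triple in direction `i`. The integer `|b_{ji}| b_{ik} + b_{ji} |b_{ik}|` is
always even. -/
noncomputable def mutate (S : SeedTriple F n m) (i : Fin n) : SeedTriple F n m where
  var := Function.update S.var (Sum.inl i) (S.newVar i)
  mat := fun j k =>
    if j = Sum.inl i ∨ k = i then -S.mat j k
    else S.mat j k +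
      (|S.mat j i| * S.mat (Sum.inl i) k + S.mat j i * |S.mat (Sum.inl i) k|) / 2

/-- `MutationEquiv S T`: the triple `T` is obtained from `S` by finitely many mutations. -/
inductive MutationEquiv (S : SeedTriple F n m) : SeedTriple F n m → Prop
  | refl : MutationEquiv S S
  | step {T : SeedTriple F n m} (i : Fin n) : MutationEquiv S T → MutationEquiv S (T.mutate i)

/-- The exchange polynomial `f_i = x_i x_i'`, as an element of the ambient field. -/
noncomputable def exchangePolynomial (S : SeedTriple F n m) (i : Fin n) : F :=
  S.var (Sum.inl i) * S.newVar i

variable (K : Type*) [CommRing K] [Algebra K F]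

/-- The Laurent polynomial ring `K[u^{±1} | u ∈ x ∪ y]` of a triple, inside the ambient field. -/
def laurentRing (S : SeedTriple F n m) : Subalgebra K F :=
  Algebra.adjoin K (Set.range S.var ∪ Set.range fun k => (S.var k)⁻¹)

/-- The upper cluster algebra: the intersection of the Laurent polynomial rings of all the triples
that are mutation-equivalent to `S`. -/
def upperClusterAlgebra (S : SeedTriple F n m) : Subalgebra K F :=
  ⨅ (T : SeedTriple F n m) (_ : MutationEquiv S T), T.laurentRing K

end SeedTriple

/-- The `𝔭`-adic valuation on a domain `A`, for a prime `𝔭` whose localization `A_𝔭` is a discrete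
valuation ring: the normalized valuation of `A_𝔭`, restricted to `A`. -/
noncomputable def primeValuation {A : Type*} [CommRing A] [IsDomain A] (p : Ideal A) [p.IsPrime]
    [IsDiscreteValuationRing (Localization.AtPrime p)] (a : A) : ℕ∞ :=
  IsDiscreteValuationRing.addVal (Localization.AtPrime p)
    (algebraMap A (Localization.AtPrime p) a)

theorem abs_mul_add_mul_abs_div_two (a b : ℤ) :
    (|a| * b + a * |b|) / 2 = max a 0 * max b 0 - max (-a) 0 * max (-b) 0 := by
  rcases le_total 0 a with ha | ha <;> rcases le_total 0 b with hb | hb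
  · rw [abs_of_nonneg ha, abs_of_nonneg hb, max_eq_left ha, max_eq_left hb,
      max_eq_right (by omega : -a ≤ 0), zero_mul, sub_zero]
    exact Int.ediv_eq_of_eq_mul_left two_ne_zero (by ring)
  · rw [abs_of_nonneg ha, abs_of_nonpos hb, max_eq_right hb, max_eq_right (by omega : -a ≤ 0)]
    simp
  · rw [abs_of_nonpos ha, abs_of_nonneg hb, max_eq_right ha, max_eq_right (by omega : -b ≤ 0)]
    simp
  · rw [abs_of_nonpos ha, abs_of_nonpos hb, max_eq_right ha, max_eq_left (by omega : 0 ≤ -b),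
      max_eq_left (by omega : 0 ≤ -a), zero_mul, zero_sub]
    exact Int.ediv_eq_of_eq_mul_left two_ne_zero (by ring)

namespace IsExchangeMatrix

variable {n m : ℕ} {B : Matrix (Fin n ⊕ Fin m) (Fin n) ℤ}

theorem apply_self (hB : IsExchangeMatrix B) (j : Fin n) : B (Sum.inl j) j = 0 := by
  obtain ⟨d, hd, h⟩ := hB
  have h1 := h j j
  have h2 : (d j : ℤ) * B (Sum.inl j) j = 0 := by omega
  exact (mul_eq_zero.1 h2).resolve_left (by have := hd j; omega)

theorem pos_iff (hB : IsExchangeMatrix B) (j k : Fin n) :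
    0 < B (Sum.inl j) k ↔ B (Sum.inl k) j < 0 := by
  obtain ⟨d, hd, h⟩ := hB
  have h1 := h j k
  have hj : (0 : ℤ) < d j := by exact_mod_cast hd j
  have hk : (0 : ℤ) < d k := by exact_mod_cast hd k
  constructor
  · intro h2
    have := mul_pos hj h2
    by_contra h3
    have := mul_nonneg hk.le (not_lt.1 h3)
    omega
  · intro h2
    have := mul_neg_of_pos_of_neg hk h2
    by_contra h3
    have := mul_nonpos_of_nonneg_of_nonpos hj.le (not_lt.1 h3)
    omega

theorem eq_zero_iff (hB : IsExchangeMatrix B) (j k : Fin n) :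
    B (Sum.inl j) k = 0 ↔ B (Sum.inl k) j = 0 := by
  have h1 := hB.pos_iff j k
  have h2 := hB.pos_iff k j
  omega

theorem neg (hB : IsExchangeMatrix B) : IsExchangeMatrix (-B) := by
  obtain ⟨d, hd, h⟩ := hB
  refine ⟨d, hd, fun j k => ?_⟩
  simp only [Matrix.neg_apply]
  linear_combination -h j k

end IsExchangeMatrix

namespace SeedTriple

theorem ext_var_mat {F : Type*} {n m : ℕ} {S T : SeedTriple F n m} (h : S.var = T.var)
    (h' : S.mat = T.mat) : S = T := by
  cases S
  cases T
  simp_all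

variable {F : Type*} [Field F] {n m : ℕ}

theorem mutate_mat_apply (S : SeedTriple F n m) (i : Fin n) (j k) :
    (S.mutate i).mat j k = if j = Sum.inl i ∨ k = i then -S.mat j k
      else S.mat j k + (max (S.mat j i) 0 * max (S.mat (Sum.inl i) k) 0
        - max (-S.mat j i) 0 * max (-S.mat (Sum.inl i) k) 0) := by
  simp only [mutate, abs_mul_add_mul_abs_div_two]

theorem mutate_mat_col (S : SeedTriple F n m) (i : Fin n) (j) :
    (S.mutate i).mat j i = -S.mat j i := by
  simp [mutate_mat_apply]

theorem mutate_mat_row (S : SeedTriple F n m) (i : Fin n) (k) :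
    (S.mutate i).mat (Sum.inl i) k = -S.mat (Sum.inl i) k := by
  simp [mutate_mat_apply]

theorem mutate_mat_of_ne (S : SeedTriple F n m) {i : Fin n} {j k} (hj : j ≠ Sum.inl i)
    (hk : k ≠ i) : (S.mutate i).mat j k = S.mat j k +
      (max (S.mat j i) 0 * max (S.mat (Sum.inl i) k) 0
        - max (-S.mat j i) 0 * max (-S.mat (Sum.inl i) k) 0) := by
  simp [mutate_mat_apply, hj, hk]

theorem mutate_var_self (S : SeedTriple F n m) (i : Fin n) :
    (S.mutate i).var (Sum.inl i) = S.newVar i := by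
  simp [mutate]

theorem mutate_var_of_ne (S : SeedTriple F n m) {i : Fin n} {k} (hk : k ≠ Sum.inl i) :
    (S.mutate i).var k = S.var k := by
  simp [mutate, hk]

theorem isExchangeMatrix_mutate {S : SeedTriple F n m} (hS : IsExchangeMatrix S.mat)
    (i : Fin n) : IsExchangeMatrix (S.mutate i).mat := by
  obtain ⟨d, hd, h⟩ := hS
  refine ⟨d, hd, fun j k => ?_⟩
  have hpos : ∀ j, (0 : ℤ) ≤ d j := fun j => by positivity
  have hmax : ∀ j k, (d j : ℤ) * max (S.mat (Sum.inl j) k) 0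
      = d k * max (-S.mat (Sum.inl k) j) 0 := fun j k => by
    rw [mul_max_of_nonneg _ _ (hpos j), mul_max_of_nonneg _ _ (hpos k), h j k]
    simp
  by_cases hj : j = i
  · subst hj
    rw [mutate_mat_row, mutate_mat_col]
    linear_combination -h j k
  by_cases hk : k = i
  · subst hk
    rw [mutate_mat_row, mutate_mat_col]
    linear_combination -h j k
  rw [mutate_mat_of_ne _ (by simpa using hj) hk, mutate_mat_of_ne _ (by simpa using hk) hj]
  linear_combination h j k + max (S.mat (Sum.inl i) k) 0 * hmax j i
    + max (-S.mat (Sum.inl i) k) 0 * hmax i j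
    + max (-S.mat (Sum.inl i) j) 0 * hmax i k
    + max (S.mat (Sum.inl i) j) 0 * hmax k i

theorem prod_pow_toNat_congr {S T : SeedTriple F n m} {i : Fin n} (hi : S.mat (Sum.inl i) i = 0)
    (h : ∀ k, k ≠ Sum.inl i → T.var k = S.var k) :
    ∏ k, T.var k ^ (S.mat k i).toNat = ∏ k, S.var k ^ (S.mat k i).toNat ∧
      ∏ k, T.var k ^ (-S.mat k i).toNat = ∏ k, S.var k ^ (-S.mat k i).toNat := by
  constructor <;> refine Finset.prod_congr rfl fun k _ => ?_ <;>
  · by_cases hk : k = Sum.inl i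
    · simp [hk, hi]
    · rw [h k hk]

theorem exchangePolynomial_eq {S : SeedTriple F n m} {i : Fin n} (hx : S.var (Sum.inl i) ≠ 0) :
    S.exchangePolynomial i =
      (∏ k, S.var k ^ (S.mat k i).toNat) + ∏ k, S.var k ^ (-S.mat k i).toNat := by
  rw [exchangePolynomial, newVar, mul_inv_cancel_left₀ hx]

theorem mutate_mutate {S : SeedTriple F n m} (hS : IsExchangeMatrix S.mat) {i : Fin n}
    (hx : S.var (Sum.inl i) ≠ 0) (hx' : S.newVar i ≠ 0) : (S.mutate i).mutate i = S := by
  have hvar : ((S.mutate i).mutate i).var = S.var := by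
    funext k
    by_cases hk : k = Sum.inl i
    · subst hk
      rw [mutate_var_self, newVar, mutate_var_self]
      have h := prod_pow_toNat_congr (T := S.mutate i) (hS.apply_self i)
        fun k hk => mutate_var_of_ne S hk
      simp only [mutate_mat_col, neg_neg]
      rw [h.1, h.2, add_comm, ← exchangePolynomial_eq hx, exchangePolynomial, mul_comm,
        mul_assoc, mul_inv_cancel₀ hx', mul_one]
    · rw [mutate_var_of_ne _ hk, mutate_var_of_ne _ hk]
  have hmat : ((S.mutate i).mutate i).mat = S.mat := by
    ext j k
    by_cases hk : k = i
    · subst hk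
      rw [mutate_mat_col, mutate_mat_col, neg_neg]
    by_cases hj : j = Sum.inl i
    · subst hj
      rw [mutate_mat_row, mutate_mat_row, neg_neg]
    rw [mutate_mat_of_ne _ hj hk, mutate_mat_of_ne _ hj hk, mutate_mat_col, mutate_mat_row]
    simp only [neg_neg]
    ring
  exact ext_var_mat hvar hmat

/-- The seed with the opposite exchange matrix. -/
def neg (S : SeedTriple F n m) : SeedTriple F n m := ⟨S.var, -S.mat⟩

theorem neg_mutate (S : SeedTriple F n m) (i : Fin n) : S.neg.mutate i = (S.mutate i).neg := by
  have h1 : (S.neg.mutate i).var = (S.mutate i).neg.var := by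
    simp [mutate, neg, newVar, add_comm]
  have h2 : (S.neg.mutate i).mat = (S.mutate i).neg.mat := by
    ext j k
    by_cases hk : k = i
    · subst hk
      simp [mutate_mat_col, neg]
    by_cases hj : j = Sum.inl i
    · subst hj
      simp [mutate_mat_row, neg]
    · simp only [mutate_mat_of_ne _ hj hk, neg, Matrix.neg_apply, neg_neg]
      ring
  exact ext_var_mat h1 h2

/-- The seed obtained by mutating successively in the listed directions. -/
noncomputable def mutations (S : SeedTriple F n m) (w : List (Fin n)) : SeedTriple F n m :=
  w.foldl mutate S

theorem mutations_cons (S : SeedTriple F n m) (i : Fin n) (w : List (Fin n)) :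
    S.mutations (i :: w) = (S.mutate i).mutations w := rfl

theorem mutations_append (S : SeedTriple F n m) (v w : List (Fin n)) :
    S.mutations (v ++ w) = (S.mutations v).mutations w := List.foldl_append

theorem neg_mutations (S : SeedTriple F n m) (w : List (Fin n)) :
    S.neg.mutations w = (S.mutations w).neg := by
  induction w generalizing S with
  | nil => rfl
  | cons i w ih => rw [mutations_cons, mutations_cons, neg_mutate, ih]

section AlgebraicIndependent

variable {K : Type*} [CommRing K] [CharZero K] [Algebra K F]

theorem exchangePolynomial_ne_zero {S : SeedTriple F n m} (hS : AlgebraicIndependent K S.var)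
    {i : Fin n} : S.exchangePolynomial i ≠ 0 := by
  let f : MvPolynomial (Fin n ⊕ Fin m) K :=
    (∏ k, .X k ^ (S.mat k i).toNat) + ∏ k, .X k ^ (-S.mat k i).toNat
  have hf : f ≠ 0 := fun h0 => by
    have h1 : MvPolynomial.eval (fun _ => 1) f = (1 : K) + 1 := by simp [f]
    rw [h0, map_zero, one_add_one_eq_two] at h1
    exact two_ne_zero h1.symm
  rw [exchangePolynomial_eq (hS.ne_zero _)]
  have h2 : MvPolynomial.aeval S.var f ≠ 0 := fun h0 => hf (hS.eq_zero_of_aeval_eq_zero _ h0)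
  simpa [f] using h2

theorem algebraicIndependent_mutate {S : SeedTriple F n m} (hS : AlgebraicIndependent K S.var)
    {i : Fin n} (hi : S.mat (Sum.inl i) i = 0) : AlgebraicIndependent K (S.mutate i).var := by
  have hx : S.var (Sum.inl i) ≠ 0 := hS.ne_zero _
  have h := (AlgebraicIndependent.iff_transcendental_adjoin_image (Sum.inl i)).1 hS
  have hcongr : ∀ k : {k // k ≠ (Sum.inl i : Fin n ⊕ Fin m)}, (S.mutate i).var k = S.var k :=
    fun k => mutate_var_of_ne S k.2
  have himage : (S.mutate i).var '' {Sum.inl i}ᶜ = S.var '' {Sum.inl i}ᶜ :=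
    Set.image_congr fun k hk => mutate_var_of_ne S hk
  refine (AlgebraicIndependent.iff_transcendental_adjoin_image (Sum.inl i)).2 ⟨?_, ?_⟩
  · simp_rw [hcongr]
    exact h.1
  rw [himage, mutate_var_self]
  intro halg
  apply h.2
  set A := Algebra.adjoin K (S.var '' {Sum.inl i}ᶜ)
  have hf : S.exchangePolynomial i ∈ A := by
    rw [exchangePolynomial_eq hx]
    refine add_mem (prod_mem fun k _ => ?_) (prod_mem fun k _ => ?_) <;>
    · by_cases hk : k = Sum.inl i
      · simp [hk, hi]
      · exact pow_mem (Algebra.subset_adjoin (Set.mem_image_of_mem _ hk)) _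
  have hne : S.newVar i ≠ 0 := right_ne_zero_of_mul (exchangePolynomial_ne_zero hS)
  have hfA : IsAlgebraic A (S.exchangePolynomial i) :=
    isAlgebraic_algebraMap (R := ↥A) (A := F) ⟨_, hf⟩
  have := hfA.mul halg.inv
  convert this using 1
  exact (mul_inv_cancel_right₀ hne _).symm

theorem algebraicIndependent_mutations {S : SeedTriple F n m}
    (hS : AlgebraicIndependent K S.var) (hB : IsExchangeMatrix S.mat) (w : List (Fin n)) :
    AlgebraicIndependent K (S.mutations w).var ∧ IsExchangeMatrix (S.mutations w).mat := by
  induction w generalizing S with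
  | nil => exact ⟨hS, hB⟩
  | cons i w ih =>
    exact ih (algebraicIndependent_mutate hS (hB.apply_self i)) (isExchangeMatrix_mutate hB i)

theorem mutations_reverse {S : SeedTriple F n m}
    (hS : AlgebraicIndependent K S.var) (hB : IsExchangeMatrix S.mat) (w : List (Fin n)) :
    (S.mutations w).mutations w.reverse = S := by
  induction w generalizing S with
  | nil => rfl
  | cons i w ih =>
    rw [List.reverse_cons, mutations_append, S.mutations_cons,
      ih (algebraicIndependent_mutate hS (hB.apply_self i)) (isExchangeMatrix_mutate hB i)]
    exact mutate_mutate hB (hS.ne_zero _) (right_ne_zero_of_mul (exchangePolynomial_ne_zero hS))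

theorem MutationEquiv.exists_mutations {S T : SeedTriple F n m} (h : MutationEquiv S T) :
    ∃ w, T = S.mutations w := by
  induction h with
  | refl => exact ⟨[], rfl⟩
  | step i _ ih =>
    obtain ⟨w, rfl⟩ := ih
    exact ⟨w ++ [i], by rw [mutations_append]; rfl⟩

end AlgebraicIndependent

end SeedTriple

namespace SeedTriple

section LaurentRing

variable {K F : Type*} [CommRing K] [Field F] [Algebra K F] {n m : ℕ}

theorem var_mem_laurentRing (S : SeedTriple F n m) (k) : S.var k ∈ S.laurentRing K :=
  Algebra.subset_adjoin (.inl ⟨k, rfl⟩)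

theorem inv_var_mem_laurentRing (S : SeedTriple F n m) (k) : (S.var k)⁻¹ ∈ S.laurentRing K :=
  Algebra.subset_adjoin (.inr ⟨k, rfl⟩)

/-- Denominators for the elements of the Laurent ring can be found among denominators for the
inverse variables. -/
theorem exists_mul_mem_of_mem_laurentRing {S : SeedTriple F n m} {R : Subalgebra K F}
    {M : Submonoid F} (hM : ∀ d ∈ M, d ∈ R) (hvar : ∀ k, S.var k ∈ R)
    (hinv : ∀ k, ∃ d ∈ M, d * (S.var k)⁻¹ ∈ R) {a : F} (ha : a ∈ S.laurentRing K) :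
    ∃ d ∈ M, d * a ∈ R := by
  induction ha using Algebra.adjoin_induction with
  | mem a ha =>
    obtain ⟨k, rfl⟩ | ⟨k, rfl⟩ := ha
    · exact ⟨1, one_mem _, by simpa using hvar k⟩
    · exact hinv k
  | algebraMap r => exact ⟨1, one_mem _, by simp⟩
  | add a b _ _ iha ihb =>
    obtain ⟨d, hd, hda⟩ := iha
    obtain ⟨e, he, heb⟩ := ihb
    refine ⟨d * e, mul_mem hd he, ?_⟩
    rw [show d * e * (a + b) = e * (d * a) + d * (e * b) by ring]
    exact add_mem (mul_mem (hM e he) hda) (mul_mem (hM d hd) heb)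
  | mul a b _ _ iha ihb =>
    obtain ⟨d, hd, hda⟩ := iha
    obtain ⟨e, he, heb⟩ := ihb
    refine ⟨d * e, mul_mem hd he, ?_⟩
    rw [show d * e * (a * b) = (d * a) * (e * b) by ring]
    exact mul_mem hda heb

theorem laurentRing_le {S : SeedTriple F n m} {R : Subalgebra K F}
    (hvar : ∀ k, S.var k ∈ R) (hinv : ∀ k, (S.var k)⁻¹ ∈ R) : S.laurentRing K ≤ R :=
  Algebra.adjoin_le (by rintro a (⟨k, rfl⟩ | ⟨k, rfl⟩); exacts [hvar k, hinv k])

variable (K) in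
/-- The substitution of the variables of a triple, with values in the Laurent ring. -/
noncomputable def toLaurentRing (S : SeedTriple F n m) :
    MvPolynomial (Fin n ⊕ Fin m) K →ₐ[K] S.laurentRing K :=
  MvPolynomial.aeval fun k => ⟨S.var k, var_mem_laurentRing S k⟩

theorem coe_toLaurentRing (S : SeedTriple F n m) (p) :
    (S.toLaurentRing K p : F) = MvPolynomial.aeval S.var p := by
  rw [toLaurentRing, ← Subalgebra.coe_val, ← AlgHom.comp_apply, MvPolynomial.comp_aeval]
  rfl

/-- The monomials with coefficient one. -/
noncomputable def monomials (K σ : Type*) [CommRing K] : Submonoid (MvPolynomial σ K) :=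
  Submonoid.closure (Set.range MvPolynomial.X)

theorem isUnit_of_mem_monomials {σ R : Type*} [CommRing R] {f : MvPolynomial σ K →+* R}
    (hf : ∀ k, IsUnit (f (.X k))) {p} (hp : p ∈ monomials K σ) : IsUnit (f p) := by
  induction hp using Submonoid.closure_induction with
  | mem x hx => obtain ⟨k, rfl⟩ := hx; exact hf k
  | one => simp
  | mul x y _ _ hx hy => rw [map_mul]; exact hx.mul hy

theorem isUnit_toLaurentRing_X {S : SeedTriple F n m} (h0 : ∀ k, S.var k ≠ 0) (k) :
    IsUnit (S.toLaurentRing K (.X k)) := by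
  refine IsUnit.of_mul_eq_one ⟨(S.var k)⁻¹, inv_var_mem_laurentRing S k⟩ (Subtype.ext ?_)
  simp [coe_toLaurentRing, h0 k]

theorem isLocalization_laurentRing [Nontrivial K] {S : SeedTriple F n m}
    (hS : AlgebraicIndependent K S.var) :
    letI := (S.toLaurentRing K).toRingHom.toAlgebra
    IsLocalization (monomials K (Fin n ⊕ Fin m)) (S.laurentRing K) := by
  let := (S.toLaurentRing K).toRingHom.toAlgebra
  have hmap : ∀ p, algebraMap (MvPolynomial (Fin n ⊕ Fin m) K) (S.laurentRing K) p
    = S.toLaurentRing K p := fun _ => rfl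
  have hcoe := coe_toLaurentRing (K := K) S
  refine ⟨fun p => ?_, fun a => ?_, fun {p q} h => ⟨1, ?_⟩⟩
  · exact isUnit_of_mem_monomials (f := (S.toLaurentRing K).toRingHom)
      (isUnit_toLaurentRing_X fun k => hS.ne_zero k) p.2
  · obtain ⟨d, hd, p, hp⟩ := exists_mul_mem_of_mem_laurentRing (S := S)
      (R := (MvPolynomial.aeval S.var : MvPolynomial _ K →ₐ[K] F).range)
      (M := (monomials K _).map (MvPolynomial.aeval S.var : MvPolynomial _ K →ₐ[K] F))
      (by rintro _ ⟨p, _, rfl⟩; exact ⟨p, rfl⟩) (fun k => ⟨.X k, by simp⟩)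
      (fun k => ⟨S.var k, ⟨.X k, Submonoid.subset_closure ⟨k, rfl⟩, by simp⟩,
        1, by simp [mul_inv_cancel₀ (hS.ne_zero k)]⟩) a.2
    obtain ⟨s, hs, rfl⟩ := hd
    refine ⟨(p, ⟨s, hs⟩), Subtype.ext ?_⟩
    simp only [hmap, Subalgebra.coe_mul, hcoe, mul_comm (a : F)]
    exact hp.symm
  · have h' := congrArg Subtype.val h
    rw [hmap, hmap, hcoe, hcoe] at h'
    rw [hS h']

/-- The universal property of the Laurent ring: the variables can be sent to arbitrary units. -/
theorem exists_ringHom_laurentRing [Nontrivial K] {S : SeedTriple F n m}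
    (hS : AlgebraicIndependent K S.var) {R : Type*} [CommRing R] [Algebra K R]
    {g : Fin n ⊕ Fin m → R} (hg : ∀ k, IsUnit (g k)) :
    ∃ f : S.laurentRing K →+* R, ∀ p, f (S.toLaurentRing K p) = MvPolynomial.aeval g p := by
  let := (S.toLaurentRing K).toRingHom.toAlgebra
  have := isLocalization_laurentRing hS
  have h : ∀ p : monomials K (Fin n ⊕ Fin m),
      IsUnit ((MvPolynomial.aeval g : MvPolynomial _ K →ₐ[K] R).toRingHom p) :=
    fun p => isUnit_of_mem_monomials (fun k => by simpa using hg k) p.2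
  exact ⟨IsLocalization.lift h, fun p => IsLocalization.lift_eq h p⟩

theorem ringHom_laurentRing_ext {S : SeedTriple F n m} (hS : AlgebraicIndependent ℤ S.var)
    {R : Type*} [CommRing R] {f g : S.laurentRing ℤ →+* R}
    (h : ∀ k, f ⟨S.var k, var_mem_laurentRing S k⟩ = g ⟨S.var k, var_mem_laurentRing S k⟩) :
    f = g := by
  let := (S.toLaurentRing ℤ).toRingHom.toAlgebra
  have := isLocalization_laurentRing hS
  refine IsLocalization.ringHom_ext (monomials ℤ (Fin n ⊕ Fin m)) ?_
  refine MvPolynomial.ringHom_ext (fun r => by simp) fun k => ?_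
  have hX : algebraMap (MvPolynomial (Fin n ⊕ Fin m) ℤ) (S.laurentRing ℤ) (.X k)
      = ⟨S.var k, var_mem_laurentRing S k⟩ := MvPolynomial.aeval_X _ _
  rw [RingHom.comp_apply, RingHom.comp_apply, hX, h k]

end LaurentRing

end SeedTriple

namespace SeedTriple

section Monomials

variable {F : Type*} [Field F] {n m : ℕ} {S : SeedTriple F n m}

/-- A variable as a unit of the Laurent ring. -/
def unitVar (h0 : ∀ k, S.var k ≠ 0) (k : Fin n ⊕ Fin m) : (S.laurentRing ℤ)ˣ where
  val := ⟨S.var k, var_mem_laurentRing S k⟩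
  inv := ⟨(S.var k)⁻¹, inv_var_mem_laurentRing S k⟩
  val_inv := Subtype.ext (mul_inv_cancel₀ (h0 k))
  inv_val := Subtype.ext (inv_mul_cancel₀ (h0 k))

/-- A Laurent monomial as a unit of the Laurent ring. -/
def monomialUnit (h0 : ∀ k, S.var k ≠ 0) (e : Fin n ⊕ Fin m → ℤ) : (S.laurentRing ℤ)ˣ :=
  ∏ k, unitVar h0 k ^ e k

variable (h0 : ∀ k, S.var k ≠ 0)

theorem monomialUnit_mul (e f : Fin n ⊕ Fin m → ℤ) :
    monomialUnit h0 e * monomialUnit h0 f = monomialUnit h0 (e + f) := by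
  simp [monomialUnit, zpow_add, Finset.prod_mul_distrib]

theorem monomialUnit_pow (e : Fin n ⊕ Fin m → ℤ) (c : ℕ) :
    monomialUnit h0 e ^ c = monomialUnit h0 (c • e) := by
  rw [monomialUnit, ← Finset.prod_pow]
  refine Finset.prod_congr rfl fun k _ => ?_
  rw [Pi.smul_apply, nsmul_eq_mul, mul_comm, zpow_mul, zpow_natCast]

theorem monomialUnit_single (k : Fin n ⊕ Fin m) :
    monomialUnit h0 (Pi.single k 1) = unitVar h0 k := by
  rw [monomialUnit, Finset.prod_eq_single k]
  · simp
  · intro l _ hl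
    simp [hl]
  · simp

theorem coe_monomialUnit (e : Fin n ⊕ Fin m → ℤ) :
    ((monomialUnit h0 e : S.laurentRing ℤ) : F) = ∏ k, S.var k ^ e k := by
  let f : (S.laurentRing ℤ)ˣ →* Fˣ := Units.map (S.laurentRing ℤ).val.toRingHom.toMonoidHom
  have hf : ∀ x, ((f x : Fˣ) : F) = ((x : S.laurentRing ℤ) : F) := fun _ => rfl
  rw [← hf, monomialUnit, map_prod, Units.coe_prod]
  refine Finset.prod_congr rfl fun k _ => ?_
  rw [map_zpow, Units.val_zpow_eq_zpow_val, hf]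
  rfl

/-- A product of powers of the variables of a triple `T` all but one of which are shared with
`S`. -/
theorem prod_pow_toNat_eq {T : SeedTriple F n m} {j : Fin n ⊕ Fin m} {e : Fin n ⊕ Fin m → ℤ}
    (h : ∀ k, k ≠ j → e k ≠ 0 → T.var k = S.var k) :
    ∏ k, T.var k ^ (e k).toNat = T.var j ^ (e j).toNat *
      (monomialUnit h0 (fun k => if k = j then 0 else max (e k) 0) : S.laurentRing ℤ) := by
  rw [coe_monomialUnit, ← Finset.mul_prod_erase _ _ (Finset.mem_univ j),
    ← Finset.mul_prod_erase _ (fun k => S.var k ^ _) (Finset.mem_univ j)]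
  simp only [if_true, zpow_zero, one_mul]
  congr 1
  refine Finset.prod_congr rfl fun k hk => ?_
  have hkj := Finset.ne_of_mem_erase hk
  rw [if_neg hkj, ← Int.toNat_eq_max, zpow_natCast]
  by_cases hek : e k = 0
  · simp [hek]
  · rw [h k hkj hek]

theorem map_monomialUnit_eq_self {f : S.laurentRing ℤ →+* S.laurentRing ℤ}
    {e : Fin n ⊕ Fin m → ℤ} (h : ∀ k, e k ≠ 0 → f (unitVar h0 k) = unitVar h0 k) :
    f (monomialUnit h0 e) = monomialUnit h0 e := by
  have : Units.map f.toMonoidHom (monomialUnit h0 e) = monomialUnit h0 e := by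
    rw [monomialUnit, map_prod]
    refine Finset.prod_congr rfl fun k _ => ?_
    rw [map_zpow]
    by_cases hek : e k = 0
    · simp [hek]
    · congr 1
      exact Units.ext (h k hek)
  exact congrArg Units.val this

theorem map_monomialUnit_eq_one {R : Type*} [CommRing R] {f : S.laurentRing ℤ →+* R}
    {e : Fin n ⊕ Fin m → ℤ} (h : ∀ k, e k ≠ 0 → f (unitVar h0 k) = 1) :
    f (monomialUnit h0 e) = 1 := by
  have : Units.map f.toMonoidHom (monomialUnit h0 e) = 1 := by
    rw [monomialUnit, map_prod]
    refine Finset.prod_eq_one fun k _ => ?_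
    rw [map_zpow]
    by_cases hek : e k = 0
    · simp [hek]
    · rw [show Units.map f.toMonoidHom (unitVar h0 k) = 1 from Units.ext (h k hek), one_zpow]
  exact congrArg Units.val this

end Monomials

section Coprimality

variable {F : Type*} [Field F] {n m : ℕ} {S : SeedTriple F n m}

/-- If `y₀` is a Laurent monomial, up to sign, that does not involve the variable `y`, then
`y - y₀` divides each `a` for which it divides `a * w`, provided that `w` has a nonzero value
somewhere where `y = y₀`. -/
theorem sub_dvd_of_sub_dvd_mul (hS : AlgebraicIndependent ℤ S.var) {l : Fin n ⊕ Fin m}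
    {e : Fin n ⊕ Fin m → ℤ} (he : e l = 0)
    {χ : S.laurentRing ℤ →+* ℚ}
    (hχ : χ (unitVar (fun k => hS.ne_zero k) l) = χ (-monomialUnit (fun k => hS.ne_zero k) e))
    {a w : S.laurentRing ℤ} (hw : χ w ≠ 0)
    (h : (↑(unitVar (fun k => hS.ne_zero k) l) + ↑(monomialUnit (fun k => hS.ne_zero k) e) :
      S.laurentRing ℤ) ∣ a * w) :
    (↑(unitVar (fun k => hS.ne_zero k) l) + ↑(monomialUnit (fun k => hS.ne_zero k) e) :
      S.laurentRing ℤ) ∣ a := by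
  have h0 : ∀ k, S.var k ≠ 0 := fun k => hS.ne_zero k
  set y := ((unitVar h0 l : (S.laurentRing ℤ)ˣ) : S.laurentRing ℤ)
  set y₀ := ((monomialUnit h0 e : (S.laurentRing ℤ)ˣ) : S.laurentRing ℤ)
  obtain ⟨ψ, hψ⟩ := exists_ringHom_laurentRing hS
    (g := fun k => if k = l then -y₀ else (unitVar h0 k : S.laurentRing ℤ)) fun k => by
      split_ifs
      · exact (Units.isUnit _).neg
      · exact Units.isUnit _
  have hX : ∀ k, S.toLaurentRing ℤ (.X k) = unitVar h0 k := fun k => MvPolynomial.aeval_X _ _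
  have hψ' : ∀ k, ψ (unitVar h0 k) = if k = l then -y₀ else (unitVar h0 k : S.laurentRing ℤ) :=
    fun k => (congrArg ψ (hX k)).symm.trans ((hψ _).trans (MvPolynomial.aeval_X _ _))
  have hy : ψ y = -y₀ := by rw [hψ', if_pos rfl]
  have hy₀ : ψ y₀ = y₀ := map_monomialUnit_eq_self h0 fun k hk => by
    rw [hψ', if_neg]
    rintro rfl
    exact hk he
  have hcongr : ∀ b, y + y₀ ∣ b - ψ b := fun b => by
    rw [← Ideal.mem_span_singleton, ← Ideal.Quotient.eq]
    suffices H : Ideal.Quotient.mk (Ideal.span {y + y₀})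
        = (Ideal.Quotient.mk (Ideal.span {y + y₀})).comp ψ from RingHom.congr_fun H b
    refine ringHom_laurentRing_ext hS fun k => ?_
    change Ideal.Quotient.mk _ (unitVar h0 k : S.laurentRing ℤ) =
      Ideal.Quotient.mk _ (ψ (unitVar h0 k))
    rw [hψ']
    split_ifs with hk
    · subst hk
      rw [Ideal.Quotient.eq, sub_neg_eq_add]
      exact Ideal.mem_span_singleton_self _
    · rfl
  have hχψ : ψ w ≠ 0 := fun h1 => by
    obtain ⟨b, hb⟩ := hcongr w
    rw [h1, sub_zero] at hb
    apply hw
    rw [hb, map_mul, map_add, hχ, map_neg, neg_add_cancel, zero_mul]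
  have hψa : ψ a = 0 := by
    obtain ⟨b, hb⟩ := h
    have h2 : ψ a * ψ w = 0 := by
      rw [← map_mul, hb, map_mul, map_add, hy, hy₀, neg_add_cancel, zero_mul]
    exact (mul_eq_zero.1 h2).resolve_right hχψ
  simpa [hψa] using hcongr a

end Coprimality

theorem mutate_var_mul_var {F : Type*} [Field F] {n m : ℕ} {S : SeedTriple F n m} {i : Fin n}
    (hx : S.var (Sum.inl i) ≠ 0) : (S.mutate i).var (Sum.inl i) * S.var (Sum.inl i) =
      (∏ k, S.var k ^ (S.mat k i).toNat) + ∏ k, S.var k ^ (-S.mat k i).toNat := by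
  rw [mutate_var_self, mul_comm, ← exchangePolynomial_eq hx, exchangePolynomial]

section RankTwo

variable {F : Type*} [Field F] {n m : ℕ}

/-- The inductive step of the Laurent phenomenon, for a seed with a frozen variable that occurs only
in the exchange polynomial of the first direction. -/
theorem mem_laurentRing_of_mem_mutate (S : SeedTriple F n m) (hS : AlgebraicIndependent ℤ S.var)
    (hB : IsExchangeMatrix S.mat) {i j : Fin n} (hij : i ≠ j) (hBij : S.mat (Sum.inl i) j ≤ 0)
    {l : Fin m} (hli : S.mat (Sum.inr l) i = 1) (hlj : S.mat (Sum.inr l) j = 0) {x : F}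
    (hx : x ∈ (S.mutate i).laurentRing ℤ)
    (hx' : x ∈ (((S.mutate i).mutate j).mutate i).laurentRing ℤ) : x ∈ S.laurentRing ℤ := by
  have h0 : ∀ k, S.var k ≠ 0 := fun k => hS.ne_zero k
  set S₁ := S.mutate i with hS₁
  set S₂ := S₁.mutate j with hS₂
  set S₃ := S₂.mutate i with hS₃
  have hB₁ : IsExchangeMatrix S₁.mat := isExchangeMatrix_mutate hB i
  have hB₂ : IsExchangeMatrix S₂.mat := isExchangeMatrix_mutate hB₁ j
  have hA₁ : AlgebraicIndependent ℤ S₁.var := algebraicIndependent_mutate hS (hB.apply_self i)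
  have hA₂ : AlgebraicIndependent ℤ S₂.var := algebraicIndependent_mutate hA₁ (hB₁.apply_self j)
  have hil : (Sum.inl i : Fin n ⊕ Fin m) ≠ Sum.inl j := by simpa using hij
  have hji : (Sum.inl j : Fin n ⊕ Fin m) ≠ Sum.inl i := hil.symm
  -- matrix entries
  obtain ⟨b, hb⟩ : ∃ b : ℕ, S.mat (Sum.inl i) j = -b := ⟨(-S.mat (Sum.inl i) j).toNat, by omega⟩
  obtain ⟨c, hc⟩ : ∃ c : ℕ, S.mat (Sum.inl j) i = c := by
    have := hB.pos_iff i j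
    exact ⟨(S.mat (Sum.inl j) i).toNat, by omega⟩
  have hbc : b = 0 ↔ c = 0 := by
    have := hB.eq_zero_iff i j
    omega
  have h₁ij : S₁.mat (Sum.inl i) j = b := by rw [hS₁, mutate_mat_row, hb, neg_neg]
  have h₁ji : S₁.mat (Sum.inl j) i = -c := by rw [hS₁, mutate_mat_col, hc]
  have h₁lj : S₁.mat (Sum.inr l) j = 0 := by
    rw [hS₁, mutate_mat_of_ne _ (by simp) hij.symm, hli, hlj, hb]
    simp
  have h₂ji : S₂.mat (Sum.inl j) i = c := by rw [hS₂, mutate_mat_row, h₁ji, neg_neg]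
  have h₂ : ∀ k, k ≠ Sum.inl j →
      S₂.mat k i = -S.mat k i - c * max (-S₁.mat k j) 0 := fun k hk => by
    rw [hS₂, mutate_mat_of_ne _ hk hij, h₁ji, hS₁, mutate_mat_col]
    simp
    ring
  -- variables
  set z := S₁.var (Sum.inl i) with hz
  set u := S₂.var (Sum.inl j) with hu
  set v := S₃.var (Sum.inl i) with hv
  have hz0 : z ≠ 0 := hA₁.ne_zero _
  have hxj0 : S.var (Sum.inl j) ≠ 0 := h0 _
  have h₁var : ∀ k, k ≠ Sum.inl i → S₁.var k = S.var k := fun k hk => mutate_var_of_ne S hk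
  have h₂var : ∀ k, k ≠ Sum.inl i → k ≠ Sum.inl j → S₂.var k = S.var k := fun k hk hk' => by
    rw [hS₂, mutate_var_of_ne _ hk', h₁var k hk]
  have h₂i : S₂.var (Sum.inl i) = z := by rw [hS₂, mutate_var_of_ne _ hil]
  have h₃var : ∀ k, k ≠ Sum.inl i → k ≠ Sum.inl j → S₃.var k = S.var k := fun k hk hk' => by
    rw [hS₃, mutate_var_of_ne _ hk, h₂var k hk hk']
  have h₃j : S₃.var (Sum.inl j) = u := by rw [hS₃, mutate_var_of_ne _ hji]
  set mon := monomialUnit h0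
  have hmon : ∀ e f, ((mon e : S.laurentRing ℤ) * mon f) = mon (e + f) := fun e f => by
    rw [← Units.val_mul, monomialUnit_mul]
  have hδ : ∀ k, (mon (Pi.single k 1) : S.laurentRing ℤ) = unitVar h0 k := fun k =>
    congrArg Units.val (monomialUnit_single h0 k)
  let δ : Fin n ⊕ Fin m → Fin n ⊕ Fin m → ℤ := fun k => Pi.single k 1
  let P : Fin n ⊕ Fin m → ℤ := fun k => if k = Sum.inl i then 0 else max (S.mat k i) 0
  let Q : Fin n ⊕ Fin m → ℤ := fun k => if k = Sum.inl i then 0 else max (-S.mat k i) 0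
  let R : Fin n ⊕ Fin m → ℤ := fun k => if k = Sum.inl i then 0 else max (S₁.mat k j) 0
  let T : Fin n ⊕ Fin m → ℤ := fun k => if k = Sum.inl i then 0 else max (-S₁.mat k j) 0
  let E : Fin n ⊕ Fin m → ℤ := fun k => if k = Sum.inl j then 0 else max (S₂.mat k i) 0
  let N : Fin n ⊕ Fin m → ℤ := fun k => if k = Sum.inl j then 0 else max (-S₂.mat k i) 0
  have hexp : c • (T - δ (Sum.inl j)) + E = (N - P) + Q := by
    funext k
    by_cases hkj : k = Sum.inl j
    · subst hkj
      simp [δ, P, Q, T, E, N, hji, hc, hB₁.apply_self j]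
    by_cases hki : k = Sum.inl i
    · subst hki
      simp [δ, P, Q, T, E, N, hil, hB₂.apply_self i]
    · have h2 := h₂ k hkj
      have h3 := max_zero_sub_max_neg_zero_eq_self (S.mat k i)
      have h4 := max_zero_sub_max_neg_zero_eq_self (S₂.mat k i)
      simp only [δ, P, Q, T, E, N, hkj, hki, if_false, Pi.add_apply, Pi.sub_apply, Pi.smul_apply,
        Pi.single_eq_of_ne hkj]
      rw [nsmul_eq_mul]
      linear_combination h4 + h2 + h3
  -- the exchange relations
  have hz1 : z * S.var (Sum.inl i) = (mon P : S.laurentRing ℤ) + (mon Q : S.laurentRing ℤ) := by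
    rw [hz, hS₁, mutate_var_mul_var (h0 _), prod_pow_toNat_eq h0 (j := Sum.inl i) fun _ _ _ => rfl,
      prod_pow_toNat_eq h0 (j := Sum.inl i) (e := fun k => -S.mat k i) fun _ _ _ => rfl,
      hB.apply_self]
    simp [P, Q, mon]
  have hu1 : u * S.var (Sum.inl j) =
      z ^ b * (mon R : S.laurentRing ℤ) + (mon T : S.laurentRing ℤ) := by
    rw [← h₁var _ hji, hu, hS₂, mutate_var_mul_var (hA₁.ne_zero _),
      prod_pow_toNat_eq h0 (T := S₁) (j := Sum.inl i) fun k hk _ => h₁var k hk,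
      prod_pow_toNat_eq h0 (T := S₁) (j := Sum.inl i) (e := fun k => -S₁.mat k j)
        fun k hk _ => h₁var k hk, h₁ij]
    simp [R, T, mon, hz]
  have hv1 : v * z = u ^ c * (mon E : S.laurentRing ℤ) + (mon N : S.laurentRing ℤ) := by
    have hvar : ∀ k, k ≠ Sum.inl j → S₂.mat k i ≠ 0 → S₂.var k = S.var k := fun k hk hk' =>
      h₂var k (by rintro rfl; exact hk' (hB₂.apply_self i)) hk
    rw [← h₂i, hv, hS₃, mutate_var_mul_var (hA₂.ne_zero _),
      prod_pow_toNat_eq h0 (T := S₂) (j := Sum.inl j) hvar,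
      prod_pow_toNat_eq h0 (T := S₂) (j := Sum.inl j) (e := fun k => -S₂.mat k i)
        fun k hk hk' => hvar k hk (neg_ne_zero.1 hk'), h₂ji]
    simp [E, N, mon, hu]
  -- the variables as elements of the Laurent ring
  obtain ⟨zL, hzL⟩ : ∃ zL : S.laurentRing ℤ, zL * unitVar h0 (Sum.inl i) = mon P + mon Q :=
    ⟨(mon P + mon Q) * ↑(unitVar h0 (Sum.inl i))⁻¹, by simp⟩
  have hzF : (zL : F) = z := by
    refine mul_right_cancel₀ (h0 (Sum.inl i)) ?_
    rw [hz1]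
    exact congrArg Subtype.val hzL
  obtain ⟨uL, huL⟩ : ∃ uL : S.laurentRing ℤ,
      uL = zL ^ b * mon (R - δ (Sum.inl j)) + mon (T - δ (Sum.inl j)) := ⟨_, rfl⟩
  have huF : (uL : F) = u := by
    refine mul_right_cancel₀ hxj0 ?_
    rw [hu1]
    have h1 : uL * unitVar h0 (Sum.inl j) = zL ^ b * mon R + mon T := by
      rw [huL, ← hδ, add_mul, mul_assoc, hmon, hmon, sub_add_cancel, sub_add_cancel]
    have h2 := congrArg Subtype.val h1
    push_cast at h2
    rw [← hzF]
    exact h2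
  -- evaluation
  obtain ⟨χ, hχ⟩ := exists_ringHom_laurentRing hS (R := ℚ)
    (g := fun k => if k = Sum.inr l then -1 else 1) fun k => by split_ifs <;> simp
  have hX : ∀ k, S.toLaurentRing ℤ (.X k) = unitVar h0 k := fun k => MvPolynomial.aeval_X _ _
  have hχ' : ∀ k, χ (unitVar h0 k) = if k = Sum.inr l then -1 else 1 :=
    fun k => by rw [← hX, hχ, MvPolynomial.aeval_X]
  have hχmon : ∀ e, e (Sum.inr l) = 0 → χ (mon e) = 1 := fun e he =>
    map_monomialUnit_eq_one h0 fun k hk => by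
      rw [hχ', if_neg]
      rintro rfl
      exact hk he
  have hδl : ∀ k, δ (Sum.inl k) (Sum.inr l) = 0 := fun k => by simp [δ]
  have hPl : P (Sum.inr l) = 1 := by simp [P, hli]
  have hQl : Q (Sum.inr l) = 0 := by simp [Q, hli]
  have hRl : R (Sum.inr l) = 0 := by simp [R, h₁lj]
  have hTl : T (Sum.inr l) = 0 := by simp [T, h₁lj]
  have h₂l : S₂.mat (Sum.inr l) i = -1 := by rw [h₂ _ (by simp), hli, h₁lj]; simp
  have hEl : E (Sum.inr l) = 0 := by simp [E, h₂l]
  have hNl : N (Sum.inr l) = 1 := by simp [N, h₂l]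
  let D : S.laurentRing ℤ := unitVar h0 (Sum.inr l) + mon (Q - P + δ (Sum.inr l))
  have hD : D = mon (δ (Sum.inr l) - P + δ (Sum.inl i)) * zL := by
    rw [← hmon, hδ, mul_assoc, mul_comm _ zL, hzL, mul_add, hmon, hmon, sub_add_cancel, hδ]
    simp only [D]
    congr 3
    abel
  have hexpD : (Q - P + δ (Sum.inr l)) (Sum.inr l) = 0 := by simp [δ, hPl, hQl]
  have hχy : χ (unitVar h0 (Sum.inr l)) = χ (-mon (Q - P + δ (Sum.inr l))) := by
    rw [hχ', if_pos rfl, map_neg, hχmon _ hexpD]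
  have hχD : χ D = 0 := by
    simp only [D]
    rw [map_add, hχy, map_neg, neg_add_cancel]
  have hχz : χ zL = 0 := by
    rw [hD, map_mul] at hχD
    exact (mul_eq_zero.1 hχD).resolve_left ((Units.isUnit _).map χ).ne_zero
  have hχu : χ uL = 0 ^ b + 1 := by
    rw [huL, map_add, map_mul, map_pow, hχz, hχmon _ (by simp [hRl, hδl]),
      hχmon _ (by simp [hTl, hδl]), mul_one]
  have hχu0 : 0 < χ uL := by rw [hχu]; positivity
  obtain ⟨G, hG, hχG⟩ : ∃ G : S.laurentRing ℤ,
      zL * G = uL ^ c - (mon (T - δ (Sum.inl j)) : S.laurentRing ℤ) ^ c ∧ 0 ≤ χ G := by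
    rcases Nat.eq_zero_or_pos c with rfl | hc0
    · exact ⟨0, by simp, by simp⟩
    · obtain ⟨b', rfl⟩ : ∃ b', b = b' + 1 := ⟨b - 1, by omega⟩
      refine ⟨zL ^ b' * mon (R - δ (Sum.inl j)) * ∑ a ∈ Finset.range c,
        uL ^ a * (mon (T - δ (Sum.inl j)) : S.laurentRing ℤ) ^ (c - 1 - a), ?_, ?_⟩
      · have hus : uL - mon (T - δ (Sum.inl j)) = zL ^ (b' + 1) * mon (R - δ (Sum.inl j)) := by
          rw [huL, add_sub_cancel_right]
        rw [← geom_sum₂_mul, hus]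
        ring
      · rw [map_mul, map_sum]
        refine mul_nonneg ?_ (Finset.sum_nonneg fun a _ => ?_)
        · rw [map_mul, map_pow, hχz, hχmon _ (by simp [hRl, hδl])]
          positivity
        · rw [map_mul, map_pow, map_pow, hχmon _ (by simp [hTl, hδl])]
          positivity
  obtain ⟨vL, hvL⟩ : ∃ vL : S.laurentRing ℤ,
      vL = G * mon E + mon (N - P) * unitVar h0 (Sum.inl i) := ⟨_, rfl⟩
  have hvF : (vL : F) = v := by
    refine mul_right_cancel₀ hz0 ?_
    rw [hv1]
    have h1 : vL * zL = uL ^ c * mon E + mon N := by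
      have h2 : (mon (T - δ (Sum.inl j)) : S.laurentRing ℤ) ^ c * mon E = mon (N - P) * mon Q := by
        rw [← Units.val_pow_eq_pow_val, monomialUnit_pow, hmon, hexp, hmon]
      have h3 : (mon N : S.laurentRing ℤ) = mon (N - P) * mon P := by rw [hmon, sub_add_cancel]
      rw [hvL, h3]
      linear_combination (mon E : S.laurentRing ℤ) * hG + (mon (N - P) : S.laurentRing ℤ) * hzL - h2
    have h2 := congrArg Subtype.val h1
    push_cast at h2
    rw [← hzF, ← huF]
    exact h2
  have hχv : 0 < χ vL := by
    rw [hvL, map_add, map_mul, map_mul, hχmon E hEl, hχmon (N - P) (by simp [hNl, hPl]), hχ',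
      if_neg (by simp)]
    linarith
  -- conclusion
  have hmemz : z ∈ S.laurentRing ℤ := hzF ▸ zL.2
  have hmemu : u ∈ S.laurentRing ℤ := huF ▸ uL.2
  have hmemv : v ∈ S.laurentRing ℤ := hvF ▸ vL.2
  have hu0 : u ≠ 0 := hA₂.ne_zero _
  have hv0 : v ≠ 0 := (algebraicIndependent_mutate hA₂ (hB₂.apply_self i)).ne_zero _
  obtain ⟨_, ⟨a, rfl⟩, ha⟩ := exists_mul_mem_of_mem_laurentRing (R := S.laurentRing ℤ)
    (M := Submonoid.powers z) (by rintro _ ⟨a, rfl⟩; exact pow_mem hmemz a)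
    (fun k => by
      by_cases hk : k = Sum.inl i
      · rwa [hk]
      · rw [h₁var k hk]; exact var_mem_laurentRing S k)
    (fun k => by
      by_cases hk : k = Sum.inl i
      · exact ⟨z, Submonoid.mem_powers z, by rw [hk, mul_inv_cancel₀ hz0]; exact one_mem _⟩
      · exact ⟨1, one_mem _, by rw [h₁var k hk, one_mul]; exact inv_var_mem_laurentRing S k⟩) hx
  obtain ⟨_, ⟨t, rfl⟩, ht⟩ := exists_mul_mem_of_mem_laurentRing (R := S.laurentRing ℤ)
    (M := Submonoid.powers (u * v))
    (by rintro _ ⟨a, rfl⟩; exact pow_mem (mul_mem hmemu hmemv) a)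
    (fun k => by
      by_cases hk : k = Sum.inl i
      · rwa [hk]
      by_cases hk' : k = Sum.inl j
      · rwa [hk', h₃j]
      · rw [h₃var k hk hk']; exact var_mem_laurentRing S k)
    (fun k => by
      by_cases hk : k = Sum.inl i
      · exact ⟨u * v, Submonoid.mem_powers _, by rwa [hk, mul_inv_cancel_right₀ hv0]⟩
      by_cases hk' : k = Sum.inl j
      · exact ⟨u * v, Submonoid.mem_powers _,
          by rwa [hk', h₃j, mul_comm u, mul_inv_cancel_right₀ hu0]⟩
      · exact ⟨1, one_mem _, by
          rw [h₃var k hk hk', one_mul]; exact inv_var_mem_laurentRing S k⟩) hx'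
  simp only at ha ht
  clear hx hx'
  induction a with
  | zero => simpa using ha
  | succ a ih =>
    refine ih ?_
    have hzD : D ∣ zL := by
      rw [hD]
      exact (Units.isUnit _).mul_left_dvd.2 dvd_rfl
    have hdvd : D ∣ ⟨z ^ (a + 1) * x, ha⟩ * (uL * vL) ^ t := by
      refine hzD.trans ⟨zL ^ a * ⟨(u * v) ^ t * x, ht⟩, Subtype.ext ?_⟩
      push_cast
      rw [hzF, huF, hvF]
      ring
    obtain ⟨B, hB⟩ := sub_dvd_of_sub_dvd_mul hS hexpD hχy
      (by rw [map_pow, map_mul]; positivity) hdvd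
    have hB' : z ^ a * x =
        ((mon (δ (Sum.inr l) - P + δ (Sum.inl i)) * B : S.laurentRing ℤ) : F) := by
      refine mul_left_cancel₀ hz0 ?_
      have h1 : (⟨z ^ (a + 1) * x, ha⟩ : S.laurentRing ℤ) =
          zL * (mon (δ (Sum.inr l) - P + δ (Sum.inl i)) * B) := by
        rw [hB]
        change D * B = _
        rw [hD]
        ring
      have h2 := congrArg Subtype.val h1
      rw [Subalgebra.coe_mul, hzF] at h2
      rw [← h2]
      ring
    rw [hB']
    exact Subtype.property _

end RankTwo

end SeedTriple

namespace SeedTriple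

section Specialization

/-- The inclusion of the vertices when a frozen vertex is added. -/
def addFrozen {n m : ℕ} : Fin n ⊕ Fin m → Fin n ⊕ Fin (m + 1) := Sum.map id Fin.castSucc

theorem prod_addFrozen {M : Type*} [CommMonoid M] {n m : ℕ} (f : Fin n ⊕ Fin (m + 1) → M) :
    ∏ k, f k = (∏ k, f (addFrozen k)) * f (Sum.inr (Fin.last m)) := by
  rw [Fintype.prod_sum_type, Fin.prod_univ_castSucc, Fintype.prod_sum_type, mul_assoc]
  rfl

/-- The matrix with an additional frozen row. -/
def addFrozenRow {n m : ℕ} (B : Matrix (Fin n ⊕ Fin m) (Fin n) ℤ) (r : Fin n → ℤ) :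
    Matrix (Fin n ⊕ Fin (m + 1)) (Fin n) ℤ :=
  Matrix.of (Sum.elim (fun j => B (Sum.inl j))
    (Fin.snoc (α := fun _ => Fin n → ℤ) (fun a => B (Sum.inr a)) r))

theorem addFrozenRow_addFrozen {n m : ℕ} (B : Matrix (Fin n ⊕ Fin m) (Fin n) ℤ) (r : Fin n → ℤ)
    (k) : addFrozenRow B r (addFrozen k) = B k := by
  rcases k with k | k
  · rfl
  · exact Fin.snoc_castSucc (α := fun _ => Fin n → ℤ) r (fun a => B (Sum.inr a)) k

theorem addFrozenRow_last {n m : ℕ} (B : Matrix (Fin n ⊕ Fin m) (Fin n) ℤ) (r : Fin n → ℤ) :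
    addFrozenRow B r (Sum.inr (Fin.last m)) = r :=
  Fin.snoc_last (α := fun _ => Fin n → ℤ) r (fun a => B (Sum.inr a))

theorem isExchangeMatrix_addFrozenRow {n m : ℕ} {B : Matrix (Fin n ⊕ Fin m) (Fin n) ℤ}
    (hB : IsExchangeMatrix B) (r : Fin n → ℤ) : IsExchangeMatrix (addFrozenRow B r) := hB

variable {F G : Type*} [Field F] [Field G] {n m : ℕ}

/-- A ring homomorphism specializes `T` to `T'` if it maps the additional frozen variable to one
and the other variables of `T` to those of `T'`. -/
structure Specializes {A : Subalgebra ℤ F} (φ : A →+* G) (T : SeedTriple F n (m + 1))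
    (T' : SeedTriple G n m) : Prop where
  mat_eq : ∀ k, T.mat (addFrozen k) = T'.mat k
  var_mem : ∀ k, T.var k ∈ A
  map_var : ∀ k, φ ⟨T.var (addFrozen k), var_mem _⟩ = T'.var k
  map_last : φ ⟨T.var (Sum.inr (Fin.last m)), var_mem _⟩ = 1

theorem Specializes.mutate {A : Subalgebra ℤ F} {φ : A →+* G} {T : SeedTriple F n (m + 1)}
    {T' : SeedTriple G n m} (h : Specializes φ T T') {i : Fin n}
    (hi : (T.mutate i).var (Sum.inl i) ∈ A) (h0 : T'.var (Sum.inl i) ≠ 0) :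
    Specializes φ (T.mutate i) (T'.mutate i) := by
  have hmem : ∀ k, (T.mutate i).var k ∈ A := fun k => by
    by_cases hk : k = Sum.inl i
    · rwa [hk]
    · rw [mutate_var_of_ne _ hk]
      exact h.var_mem k
  have hne : T.var (Sum.inl i) ≠ 0 := fun h1 => by
    apply h0
    rw [← h.map_var, ← map_zero φ]
    exact congrArg φ (Subtype.ext h1)
  have hmat : ∀ k, T.mat (addFrozen k) i = T'.mat k i := fun k => by rw [h.mat_eq]
  have hprod : ∀ e : Fin n ⊕ Fin (m + 1) → ℕ,
      φ (∏ k, (⟨T.var k, h.var_mem k⟩ : A) ^ e k) = ∏ k, T'.var k ^ e (addFrozen k) := fun e => by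
    rw [prod_addFrozen, map_mul, map_pow, h.map_last, one_pow, mul_one, map_prod]
    exact Finset.prod_congr rfl fun k _ => by rw [map_pow, h.map_var]
  have hnew : φ ⟨(T.mutate i).var (Sum.inl i), hi⟩ = (T'.mutate i).var (Sum.inl i) := by
    refine mul_right_cancel₀ h0 ?_
    rw [mutate_var_mul_var h0, ← h.map_var (Sum.inl i), ← map_mul]
    simp_rw [← hmat]
    rw [← hprod fun k => (T.mat k i).toNat, ← hprod fun k => (-T.mat k i).toNat, ← map_add]
    congr 1
    refine Subtype.ext ?_
    push_cast
    exact mutate_var_mul_var hne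
  refine ⟨fun k => ?_, hmem, fun k => ?_, ?_⟩
  · funext j
    have hk : addFrozen k = (Sum.inl i : Fin n ⊕ Fin (m + 1)) ↔ k = Sum.inl i := by
      rcases k with k | k <;> simp [addFrozen]
    have h1 : T.mat (Sum.inl i) = T'.mat (Sum.inl i) := h.mat_eq (Sum.inl i)
    rw [mutate_mat_apply, mutate_mat_apply, h.mat_eq, h1]
    simp only [hk]
  · by_cases hk : k = Sum.inl i
    · subst hk
      exact hnew
    · rw [mutate_var_of_ne _ hk, ← h.map_var]
      congr 2
      refine mutate_var_of_ne _ ?_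
      rcases k with k | k
      · simpa [addFrozen] using hk
      · simp [addFrozen]
  · rw [← h.map_last]
    congr 2

/-- The Laurent phenomenon is inherited when a frozen variable is specialized to one. -/
theorem mem_laurentRing_of_addFrozen {S : SeedTriple F n (m + 1)} {S' : SeedTriple G n m}
    (hS : AlgebraicIndependent ℤ S.var) (hS' : AlgebraicIndependent ℤ S'.var)
    (hB' : IsExchangeMatrix S'.mat) (hmat : ∀ k, S.mat (addFrozen k) = S'.mat k)
    {w : List (Fin n)} (hw : ∀ w', w' <+: w → ∀ k, (S.mutations w').var k ∈ S.laurentRing ℤ) (k) :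
    (S'.mutations w).var k ∈ S'.laurentRing ℤ := by
  have h0 : ∀ k, S'.var k ≠ 0 := fun k => hS'.ne_zero k
  let g : Fin n ⊕ Fin (m + 1) → (S'.laurentRing ℤ)ˣ :=
    Sum.elim (fun j => unitVar h0 (Sum.inl j))
      (Fin.snoc (α := fun _ => (S'.laurentRing ℤ)ˣ) (fun a => unitVar h0 (Sum.inr a)) 1)
  have hg : ∀ k, g (addFrozen k) = unitVar h0 k := fun k => by
    rcases k with k | k
    · rfl
    · exact Fin.snoc_castSucc (α := fun _ => (S'.laurentRing ℤ)ˣ) 1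
        (fun a => unitVar h0 (Sum.inr a)) k
  have hg' : g (Sum.inr (Fin.last m)) = 1 :=
    Fin.snoc_last (α := fun _ => (S'.laurentRing ℤ)ˣ) 1 (fun a => unitVar h0 (Sum.inr a))
  obtain ⟨φ, hφ⟩ := exists_ringHom_laurentRing hS (g := fun k => (g k : S'.laurentRing ℤ))
    fun k => Units.isUnit _
  have hX : ∀ k, φ ⟨S.var k, var_mem_laurentRing S k⟩ = g k := fun k =>
    (congrArg φ (MvPolynomial.aeval_X _ k).symm).trans ((hφ _).trans (MvPolynomial.aeval_X _ _))
  let ψ : S.laurentRing ℤ →+* G := (S'.laurentRing ℤ).val.toRingHom.comp φ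
  have hψ : Specializes ψ S S' := by
    refine ⟨hmat, var_mem_laurentRing S, fun k => ?_, ?_⟩
    · change ((φ _ : S'.laurentRing ℤ) : G) = _
      rw [hX, hg]
      rfl
    · change ((φ _ : S'.laurentRing ℤ) : G) = _
      rw [hX, hg']
      rfl
  have key : Specializes ψ (S.mutations w) (S'.mutations w) := by
    induction w using List.reverseRecOn with
    | nil => exact hψ
    | append_singleton w i ih =>
      have h1 := hw _ List.prefix_rfl (Sum.inl i)
      rw [mutations_append] at h1
      rw [mutations_append, mutations_append]
      exact (ih fun w' hw' => hw w' (hw'.trans (List.prefix_append _ _))).mutate h1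
        ((algebraicIndependent_mutations hS' hB' w).1.ne_zero _)
  rw [← key.map_var]
  exact Subtype.property _

end Specialization

section LaurentPhenomenon

theorem algebraicIndependent_map_X {σ F : Type*} [Field F] {f : MvPolynomial σ ℤ →+* F}
    (hf : Function.Injective f) : AlgebraicIndependent ℤ fun k => f (.X k) := by
  rw [algebraicIndependent_iff_injective_aeval]
  have h : (MvPolynomial.aeval fun k => f (.X k)).toRingHom = f :=
    MvPolynomial.ringHom_ext (fun r => by simp) fun k => by simp
  intro p q hpq
  refine hf ?_
  rw [← h]
  exact hpq

/-- Every matrix is the matrix of a triple of independent variables. -/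
theorem exists_algebraicIndependent {n m : ℕ} (B : Matrix (Fin n ⊕ Fin m) (Fin n) ℤ) :
    ∃ (F : Type) (_ : Field F) (S : SeedTriple F n m),
      AlgebraicIndependent ℤ S.var ∧ S.mat = B :=
  ⟨FractionRing (MvPolynomial (Fin n ⊕ Fin m) ℤ), inferInstance, ⟨_, B⟩,
    algebraicIndependent_map_X (f := algebraMap (MvPolynomial (Fin n ⊕ Fin m) ℤ) _)
      (IsFractionRing.injective _ _), rfl⟩

/-- The Laurent phenomenon, with bounded length and in the lowest universe. -/
theorem mutations_var_mem_laurentRing_of_length_le (N : ℕ) :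
    ∀ {n m : ℕ} {F : Type} [Field F] (S : SeedTriple F n m), AlgebraicIndependent ℤ S.var →
      IsExchangeMatrix S.mat → ∀ w : List (Fin n), w.length ≤ N →
      ∀ k, (S.mutations w).var k ∈ S.laurentRing ℤ := by
  induction N with
  | zero =>
    intro n m F _ S hS hB w hw k
    rw [List.eq_nil_of_length_eq_zero (Nat.le_zero.1 hw)]
    exact var_mem_laurentRing S k
  | succ N ih =>
    have main : ∀ {n m : ℕ} {F : Type} [Field F] (S : SeedTriple F n m),
        AlgebraicIndependent ℤ S.var → IsExchangeMatrix S.mat →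
        ∀ {i j : Fin n} {w : List (Fin n)}, i ≠ j → S.mat (Sum.inl i) j ≤ 0 → w.length + 1 ≤ N →
        ∀ k, (S.mutations (i :: j :: w)).var k ∈ S.laurentRing ℤ := by
      intro n m F _ S hS hB i j w hij hBij hw k
      obtain ⟨F', _, S', hS', hmat⟩ :=
        exists_algebraicIndependent (addFrozenRow S.mat (Pi.single i 1))
      have hB' : IsExchangeMatrix S'.mat := hmat ▸ isExchangeMatrix_addFrozenRow hB _
      have hA₁ := algebraicIndependent_mutate hS' (hB'.apply_self i)
      have hB₁ := isExchangeMatrix_mutate hB' i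
      have hA₂ := algebraicIndependent_mutate hA₁ (hB₁.apply_self j)
      have hB₂ := isExchangeMatrix_mutate hB₁ j
      have hA₃ := algebraicIndependent_mutate hA₂ (hB₂.apply_self i)
      have hB₃ := isExchangeMatrix_mutate hB₂ i
      refine mem_laurentRing_of_addFrozen hS' hS hB
        (fun k => by rw [hmat, addFrozenRow_addFrozen]) (fun w' hw' k => ?_) k
      by_cases hlen : w'.length ≤ N
      · exact ih S' hS' hB' w' hlen k
      · obtain rfl : w' = i :: j :: w := hw'.eq_of_length_le (by simp; omega)
        refine mem_laurentRing_of_mem_mutate S' hS' hB' hij (by rwa [hmat]) (l := Fin.last m) ?_ ?_ ?_ ?_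
        · rw [hmat, addFrozenRow_last, Pi.single_eq_same]
        · rw [hmat, addFrozenRow_last, Pi.single_eq_of_ne hij.symm]
        · exact ih _ hA₁ hB₁ (j :: w) (by simpa using hw) k
        · have h1 := ih _ hA₃ hB₃ (i :: w) (by simpa using hw) k
          rwa [mutations_cons, mutate_mutate hB₂ (hA₂.ne_zero _)
            (right_ne_zero_of_mul (exchangePolynomial_ne_zero hA₂))] at h1
    intro n m F _ S hS hB w hw k
    match w with
    | [] => exact var_mem_laurentRing S k
    | [i] =>
      change (S.mutate i).var k ∈ _
      by_cases hk : k = Sum.inl i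
      · rw [hk, mutate_var_self]
        exact mul_mem (inv_var_mem_laurentRing S _) (add_mem
          (prod_mem fun k _ => pow_mem (var_mem_laurentRing S k) _)
          (prod_mem fun k _ => pow_mem (var_mem_laurentRing S k) _))
      · rw [mutate_var_of_ne _ hk]
        exact var_mem_laurentRing S k
    | i :: j :: w =>
      by_cases hij : i = j
      · subst hij
        rw [mutations_cons, mutations_cons, mutate_mutate hB (hS.ne_zero _)
          (right_ne_zero_of_mul (exchangePolynomial_ne_zero hS))]
        exact ih S hS hB w (by simp at hw; omega) k
      rcases le_total (S.mat (Sum.inl i) j) 0 with hBij | hBij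
      · exact main S hS hB hij hBij (by simpa using hw) k
      · have h1 := main S.neg hS hB.neg hij (w := w) (by simpa [neg] using hBij)
          (by simpa using hw) k
        rw [neg_mutations] at h1
        exact h1

/-- The Laurent phenomenon. -/
theorem mutations_var_mem_laurentRing {F : Type*} [Field F] {n m : ℕ} {S : SeedTriple F n m}
    (hS : AlgebraicIndependent ℤ S.var) (hB : IsExchangeMatrix S.mat) (w : List (Fin n)) (k) :
    (S.mutations w).var k ∈ S.laurentRing ℤ := by
  obtain ⟨F', _, S', hS', hmat⟩ := exists_algebraicIndependent (addFrozenRow S.mat 0)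
  exact mem_laurentRing_of_addFrozen hS' hS hB (fun k => by rw [hmat, addFrozenRow_addFrozen])
    (fun w' _ => mutations_var_mem_laurentRing_of_length_le w'.length S' hS'
      (hmat ▸ isExchangeMatrix_addFrozenRow hB _) w' le_rfl) k

end LaurentPhenomenon

end SeedTriple

section Contraction

variable {A B : Type*} [CommRing A] [IsDomain A] [CommRing B] [IsDomain B] [Algebra A B]

/-- If every element of the Noetherian domain `B` has a denominator in `A` that is a unit of `B`, then
the contraction to `A` of a principal prime ideal of `B` has the same localization, a discrete
valuation ring. -/
theorem exists_isDiscreteValuationRing_comap [IsNoetherianRing B]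
    (hinj : Function.Injective (algebraMap A B))
    (hden : ∀ b : B, ∃ s a : A, IsUnit (algebraMap A B s) ∧ b * algebraMap A B s = algebraMap A B a)
    {q : B} (hq : Prime q) :
    ∃ (p : Ideal A) (_ : p.IsPrime) (_ : IsDiscreteValuationRing (Localization.AtPrime p)),
      (∀ a, a ∈ p ↔ q ∣ algebraMap A B a) ∧ p.height = 1 ∧
      (∀ a g, algebraMap A B a = q * g → ¬ q ∣ g → primeValuation p a = 1) ∧
      (∀ a, ¬ q ∣ algebraMap A B a → primeValuation p a = 0) := by
  have hqp : (Ideal.span {q}).IsPrime := (Ideal.span_singleton_prime hq.ne_zero).2 hq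
  let M : Submonoid A := (IsUnit.submonoid B).comap (algebraMap A B)
  have hM : IsLocalization M B := by
    refine ⟨fun s => s.2, fun b => ?_, fun {x y} h => ⟨1, by rw [hinj h]⟩⟩
    obtain ⟨s, a, hs, h⟩ := hden b
    exact ⟨(a, ⟨s, hs⟩), h⟩
  let Bq := Localization.AtPrime (Ideal.span {q})
  have hloc : IsLocalization.AtPrime Bq ((Ideal.span {q}).comap (algebraMap A B)) :=
    IsLocalization.isLocalization_isLocalization_atPrime_isLocalization M Bq _
  set p := (Ideal.span {q}).comap (algebraMap A B) with hp
  have hmem : ∀ a, a ∈ p ↔ q ∣ algebraMap A B a := fun a => by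
    rw [hp, Ideal.mem_comap, Ideal.mem_span_singleton]
  have hpp : p.IsPrime := Ideal.comap_isPrime _ _
  have hmax : IsLocalRing.maximalIdeal Bq = Ideal.span {algebraMap B Bq q} := by
    rw [← Localization.AtPrime.map_eq_maximalIdeal, Ideal.map_span, Set.image_singleton]
  have hinjB : Function.Injective (algebraMap B Bq) :=
    IsLocalization.injective Bq (Ideal.span {q}).primeCompl_le_nonZeroDivisors
  have hq0 : algebraMap B Bq q ≠ 0 := fun h => hq.ne_zero (hinjB (h.trans (map_zero _).symm))
  have hnf : ¬ IsField Bq := fun h => by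
    rw [IsLocalRing.isField_iff_maximalIdeal_eq, hmax, Ideal.span_singleton_eq_bot] at h
    exact hq0 h
  have hNoeth : IsNoetherianRing Bq :=
    IsLocalization.isNoetherianRing (Ideal.span {q}).primeCompl Bq inferInstance
  have hprinc : (IsLocalRing.maximalIdeal Bq).IsPrincipal := ⟨_, hmax⟩
  have hDVR : IsDiscreteValuationRing Bq :=
    ((IsDiscreteValuationRing.TFAE Bq hnf).out 0 4).2 hprinc
  let e : Bq ≃ₐ[A] Localization.AtPrime p := IsLocalization.algEquiv p.primeCompl _ _
  have hDVR' : IsDiscreteValuationRing (Localization.AtPrime p) :=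
    IsDiscreteValuationRing.RingEquivClass.isDiscreteValuationRing e.toRingEquiv
  have he : ∀ a, algebraMap A (Localization.AtPrime p) a = e (algebraMap B Bq (algebraMap A B a)) :=
    fun a => by rw [← IsScalarTower.algebraMap_apply, e.commutes]
  refine ⟨p, hpp, hDVR', hmem, ?_, fun a g hag hg => ?_, fun a ha => ?_⟩
  · have h := IsLocalization.AtPrime.ringKrullDim_eq_height p (Localization.AtPrime p)
    rw [IsDiscreteValuationRing.ringKrullDim_eq_one] at h
    exact_mod_cast h.symm
  · refine IsDiscreteValuationRing.addVal_uniformizer ?_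
    rw [he, MulEquiv.irreducible_iff e, hag, map_mul]
    have hunit : IsUnit (algebraMap B Bq g) :=
      IsLocalization.map_units Bq (⟨g, fun h => hg (Ideal.mem_span_singleton.1 h)⟩ :
        (Ideal.span {q}).primeCompl)
    rw [irreducible_mul_isUnit hunit]
    exact (IsDiscreteValuationRing.irreducible_iff_uniformizer _).2 hmax
  · refine IsDiscreteValuationRing.addVal_eq_zero_iff.2 ?_
    exact IsLocalization.map_units (Localization.AtPrime p)
      (⟨a, fun h => ha ((hmem a).1 h)⟩ : p.primeCompl)

end Contraction

namespace SeedTriple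

section UpperClusterAlgebra

variable {K F : Type*} [CommRing K] [Field F] [Algebra K F] {n m : ℕ}
  {S : SeedTriple F n m}

theorem laurentRing_int_le {a : F} (ha : a ∈ S.laurentRing ℤ) : a ∈ S.laurentRing K := by
  let R : Subalgebra ℤ F := subalgebraOfSubring (S.laurentRing K).toSubring
  exact laurentRing_le (R := R) (var_mem_laurentRing (K := K) S)
    (inv_var_mem_laurentRing (K := K) S) ha

theorem mem_upperClusterAlgebra_iff {a : F} :
    a ∈ S.upperClusterAlgebra K ↔ ∀ w, a ∈ (S.mutations w).laurentRing K := by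
  have hw : ∀ w, MutationEquiv S (S.mutations w) := fun w => by
    induction w using List.reverseRecOn with
    | nil => exact .refl
    | append_singleton w i ih => rw [mutations_append]; exact .step i ih
  simp only [upperClusterAlgebra, Algebra.mem_iInf]
  refine ⟨fun h w => h _ (hw w), fun h T hT => ?_⟩
  obtain ⟨w, rfl⟩ := hT.exists_mutations
  exact h w

theorem mutations_var_mem_upperClusterAlgebra [CharZero K] (hS : AlgebraicIndependent K S.var)
    (hB : IsExchangeMatrix S.mat) (v : List (Fin n)) (k) :
    (S.mutations v).var k ∈ S.upperClusterAlgebra K := by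
  refine mem_upperClusterAlgebra_iff.2 fun w => laurentRing_int_le ?_
  have hS' : AlgebraicIndependent ℤ S.var :=
    hS.restrictScalars (RingHom.injective_int (algebraMap ℤ K))
  have h := algebraicIndependent_mutations hS' hB w
  have h1 := mutations_var_mem_laurentRing h.1 h.2 (w.reverse ++ v) k
  rwa [mutations_append, mutations_reverse hS' hB] at h1

theorem mutations_var_inr (w : List (Fin n)) (a : Fin m) :
    (S.mutations w).var (Sum.inr a) = S.var (Sum.inr a) := by
  induction w generalizing S with
  | nil => rfl
  | cons i w ih => rw [mutations_cons, ih, mutate_var_of_ne _ (by simp)]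

theorem inv_frozen_mem_upperClusterAlgebra (a : Fin m) :
    (S.var (Sum.inr a))⁻¹ ∈ S.upperClusterAlgebra K :=
  mem_upperClusterAlgebra_iff.2 fun w => by
    rw [← mutations_var_inr w]
    exact inv_var_mem_laurentRing _ _

theorem upperClusterAlgebra_le (w : List (Fin n)) :
    S.upperClusterAlgebra K ≤ (S.mutations w).laurentRing K :=
  fun _ ha => mem_upperClusterAlgebra_iff.1 ha w

theorem isNoetherianRing_laurentRing [Nontrivial K] [IsNoetherianRing K]
    (hS : AlgebraicIndependent K S.var) :
    IsNoetherianRing (S.laurentRing K) := by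
  let := (S.toLaurentRing K).toRingHom.toAlgebra
  have := isLocalization_laurentRing hS
  exact IsLocalization.isNoetherianRing (monomials K (Fin n ⊕ Fin m)) _ inferInstance

end UpperClusterAlgebra

end SeedTriple

namespace SeedTriple

section PrimeFactor

variable {K F : Type*} [CommRing K] [Field F] [Algebra K F] {n m : ℕ} {S : SeedTriple F n m}

theorem prime_toLaurentRing [Nontrivial K] (hS : AlgebraicIndependent K S.var)
    {b : MvPolynomial (Fin n ⊕ Fin m) K} (hb : Prime b) {R : Type*} [CommRing R]
    {f : MvPolynomial (Fin n ⊕ Fin m) K →+* R} (hX : ∀ k, IsUnit (f (.X k)))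
    (hfb : ¬ IsUnit (f b)) : Prime (S.toLaurentRing K b) := by
  let := (S.toLaurentRing K).toRingHom.toAlgebra
  have := isLocalization_laurentRing hS
  have hne : S.toLaurentRing K b ≠ 0 := fun h => by
    refine hb.ne_zero (hS.eq_zero_of_aeval_eq_zero _ ?_)
    rw [← coe_toLaurentRing, h]
    rfl
  have h1 := IsLocalization.isPrime_of_isPrime_disjoint (monomials K (Fin n ⊕ Fin m))
    (S.laurentRing K) (Ideal.span {b}) ((Ideal.span_singleton_prime hb.ne_zero).2 hb) (by
      rw [Set.disjoint_left]
      intro p hp hpb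
      obtain ⟨c, rfl⟩ := Ideal.mem_span_singleton.1 hpb
      have := isUnit_of_mem_monomials hX hp
      rw [map_mul] at this
      exact hfb (isUnit_of_mul_isUnit_left this))
  rw [Ideal.map_span, Set.image_singleton] at h1
  exact (Ideal.span_singleton_prime hne).1 h1

theorem toLaurentRing_binomial (e : Fin n ⊕ Fin m → ℤ) :
    ((S.toLaurentRing K ((∏ k, .X k ^ (e k).toNat) + ∏ k, .X k ^ (-e k).toNat) :
      S.laurentRing K) : F) = (∏ k, S.var k ^ (e k).toNat) + ∏ k, S.var k ^ (-e k).toNat := by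
  rw [coe_toLaurentRing]
  simp only [map_add, map_prod, map_pow, MvPolynomial.aeval_X]

/-- A binomial without a monomial common factor has a simple prime factor in the Laurent ring, unless
it is constant. -/
theorem exists_prime_factor_of_ne_zero [IsDomain K] [CharZero K] [UniqueFactorizationMonoid K]
    (hS : AlgebraicIndependent K S.var) {e : Fin n ⊕ Fin m → ℤ} {l : Fin n ⊕ Fin m}
    (hl : e l ≠ 0) :
    ∃ q : S.laurentRing K, Prime q ∧ ∃ g : S.laurentRing K,
      (∏ k, S.var k ^ (e k).toNat) + ∏ k, S.var k ^ (-e k).toNat = (q : F) * g ∧ ¬ q ∣ g := by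
  let Ω := AlgebraicClosure (FractionRing K)
  have hΩ : CharZero Ω := charZero_of_injective_algebraMap (R := K) (by
    rw [IsScalarTower.algebraMap_eq K (FractionRing K) Ω]
    exact (algebraMap (FractionRing K) Ω).injective.comp
      (IsFractionRing.injective K (FractionRing K)))
  set N := (e l).natAbs with hN
  have hN0 : 0 < N := Int.natAbs_pos.2 hl
  obtain ⟨α, hα⟩ := IsAlgClosed.exists_pow_nat_eq (-1 : Ω) hN0
  have hα0 : α ≠ 0 := by
    rintro rfl
    rw [zero_pow hN0.ne'] at hα
    exact one_ne_zero (neg_eq_zero.1 hα.symm)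
  let d : DualNumber Ω := (α, 1)
  have hd : IsUnit d := TrivSqZeroExt.isUnit_iff_isUnit_fst.2 hα0.isUnit
  let g : Fin n ⊕ Fin m → DualNumber Ω := fun k => if k = l then d else 1
  have hg : ∀ k, IsUnit (g k) := fun k => by
    simp only [g]
    split_ifs
    exacts [hd, isUnit_one]
  obtain ⟨χ, hχ⟩ := exists_ringHom_laurentRing hS hg
  let ev : MvPolynomial (Fin n ⊕ Fin m) K →+* Ω :=
    (TrivSqZeroExt.fstHom Ω Ω Ω).toRingHom.comp (MvPolynomial.aeval g).toRingHom
  have hev : ∀ p, ev p = (MvPolynomial.aeval g p).fst := fun _ => rfl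
  let f : MvPolynomial (Fin n ⊕ Fin m) K :=
    (∏ k, .X k ^ (e k).toNat) + ∏ k, .X k ^ (-e k).toNat
  have hprod : ∀ a : Fin n ⊕ Fin m → ℕ, ∏ k, g k ^ a k = d ^ a l := fun a => by
    rw [Finset.prod_eq_single l (fun k _ hk => by simp [g, hk]) (by simp)]
    simp [g]
  have hf : MvPolynomial.aeval g f = d ^ N + 1 := by
    simp only [f, map_add, map_prod, map_pow, MvPolynomial.aeval_X, hprod]
    rcases le_total 0 (e l) with h | h
    · rw [show (e l).toNat = N by omega, show (-e l).toNat = 0 by omega, pow_zero]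
    · rw [show (e l).toNat = 0 by omega, show (-e l).toNat = N by omega, pow_zero, add_comm]
  have hfst : ev f = 0 := by
    rw [hev, hf, TrivSqZeroExt.fst_add, TrivSqZeroExt.fst_pow, TrivSqZeroExt.fst_one]
    change α ^ N + 1 = 0
    rw [hα, neg_add_cancel]
  have hsnd : (MvPolynomial.aeval g f).snd ≠ 0 := by
    rw [hf, TrivSqZeroExt.snd_add, TrivSqZeroExt.snd_pow, TrivSqZeroExt.snd_one, add_zero]
    change N • α ^ (N - 1) • (1 : Ω) ≠ 0
    rw [smul_eq_mul, mul_one, nsmul_eq_mul]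
    exact mul_ne_zero (Nat.cast_ne_zero.2 hN0.ne') (pow_ne_zero _ hα0)
  have hf0 : f ≠ 0 := fun h => hsnd (by rw [h, map_zero]; rfl)
  obtain ⟨s, hs, hsf⟩ := UniqueFactorizationMonoid.exists_prime_factors f hf0
  obtain ⟨b, hb, hbev⟩ : ∃ b ∈ s, ev b = 0 := by
    have h1 : ev s.prod = 0 := by
      obtain ⟨u, hu⟩ := hsf.symm
      rw [← hu, map_mul, hfst, zero_mul]
    rw [map_multiset_prod, Multiset.prod_eq_zero_iff, Multiset.mem_map] at h1
    exact h1
  obtain ⟨c, hc⟩ : b ∣ f := (Multiset.dvd_prod hb).trans hsf.dvd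
  refine ⟨S.toLaurentRing K b, prime_toLaurentRing hS (hs b hb) (f := ev) (fun k => ?_) ?_,
    S.toLaurentRing K c, ?_, ?_⟩
  · rw [hev, MvPolynomial.aeval_X]
    exact TrivSqZeroExt.isUnit_iff_isUnit_fst.1 (hg k)
  · rw [hbev]
    exact not_isUnit_zero
  · rw [← Subalgebra.coe_mul, ← map_mul, ← hc, toLaurentRing_binomial]
  · rintro ⟨h, hh⟩
    apply hsnd
    have hsq : χ (S.toLaurentRing K b) * χ (S.toLaurentRing K b) = 0 := by
      have h0 : (χ (S.toLaurentRing K b)).fst = 0 := by rw [hχ, ← hev, hbev]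
      ext <;> simp [h0]
    rw [← hχ, hc, map_mul, hh, map_mul, map_mul, ← mul_assoc, hsq, zero_mul]
    rfl

theorem prime_two_of_ringEquiv_int (φ : K ≃+* ℤ) : Prime (2 : K) := by
  rw [← MulEquiv.prime_iff φ, map_ofNat]
  exact Int.prime_two

theorem exists_prime_factor_of_eq_zero [IsDomain K] (φ : K ≃+* ℤ)
    (hS : AlgebraicIndependent K S.var) {e : Fin n ⊕ Fin m → ℤ} (he : ∀ k, e k = 0) :
    ∃ q : S.laurentRing K, Prime q ∧ ∃ g : S.laurentRing K,
      (∏ k, S.var k ^ (e k).toNat) + ∏ k, S.var k ^ (-e k).toNat = (q : F) * g ∧ ¬ q ∣ g := by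
  have h2 := prime_two_of_ringEquiv_int φ
  have hq : Prime (S.toLaurentRing K (.C 2)) :=
    prime_toLaurentRing hS ((MvPolynomial.prime_C_iff _).2 h2)
      (f := MvPolynomial.eval fun _ => 1) (by simp) (by simpa using h2.not_isUnit)
  refine ⟨_, hq, 1, ?_, fun h => hq.not_isUnit (isUnit_of_dvd_one h)⟩
  rw [coe_toLaurentRing]
  simp [he, one_add_one_eq_two, map_ofNat (algebraMap K F) 2]

end PrimeFactor

theorem exists_mat_ne_zero_of_not_isIsolatedVertex {n m : ℕ}
    {B : Matrix (Fin n ⊕ Fin m) (Fin n) ℤ} (hB : IsExchangeMatrix B) {i : Fin n}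
    (h : ¬ IsIsolatedVertex B (Sum.inl i)) : ∃ k, B k i ≠ 0 := by
  by_contra! h0
  refine h fun w => ⟨?_, ?_⟩
  · rcases w with j | a
    · simp [iceQuiverArrows, (hB.eq_zero_iff j i).1 (h0 _)]
    · simp [iceQuiverArrows, h0]
  · rcases w with j | a <;> simp [iceQuiverArrows, h0]

end SeedTriple

theorem corollary3p2 {K F : Type*} [CommRing K] [IsDomain K] [CharZero K]
    (hK : IsField K ∨ Nonempty (K ≃+* ℤ))
    [Field F] [Algebra K F] {n m : ℕ}
    (S : SeedTriple F n m) (hS : S.IsSeed K)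
    (hiso : IsField K → ∀ j : Fin n, ¬ IsIsolatedVertex S.mat (Sum.inl j))
    (i : Fin n) :
    ∃ hx : ∀ j : Fin n, S.var (Sum.inl j) ∈ S.upperClusterAlgebra K,
    ∃ (p : Ideal (S.upperClusterAlgebra K)) (_ : p.IsPrime)
      (_ : IsDiscreteValuationRing (Localization.AtPrime p)),
      p.height = 1 ∧
      primeValuation p ⟨S.var (Sum.inl i), hx i⟩ = 1 ∧
      (∀ j : Fin n, j ≠ i → primeValuation p ⟨S.var (Sum.inl j), hx j⟩ = 0) ∧
      -- `p` is the contraction of `(q)` for a simple prime factor `q` of `f_i` in the Laurent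
      -- polynomial ring of the seed mutated at `i`
      ∃ q : (S.mutate i).laurentRing K, Prime q ∧
        (∃ g : (S.mutate i).laurentRing K,
          S.exchangePolynomial i = (q : F) * (g : F) ∧ ¬ q ∣ g) ∧
        ∀ u : S.upperClusterAlgebra K,
          u ∈ p ↔ ∃ c : (S.mutate i).laurentRing K, (u : F) = (q : F) * (c : F) := by
  have hA := hS.algebraicIndependent
  have hB := hS.isExchangeMatrix
  have hA' := SeedTriple.algebraicIndependent_mutate hA (hB.apply_self i)
  have hPID : IsPrincipalIdealRing K := by
    rcases hK with h | ⟨⟨φ⟩⟩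
    · exact h.isPrincipalIdealRing
    · exact IsPrincipalIdealRing.of_surjective φ.symm φ.symm.surjective
  have hf : S.exchangePolynomial i = (∏ k, (S.mutate i).var k ^ (S.mat k i).toNat)
      + ∏ k, (S.mutate i).var k ^ (-S.mat k i).toNat := by
    have h := SeedTriple.prod_pow_toNat_congr (T := S.mutate i) (hB.apply_self i)
      fun k hk => SeedTriple.mutate_var_of_ne S hk
    rw [SeedTriple.exchangePolynomial_eq (hA.ne_zero _), h.1, h.2]
  obtain ⟨q, hq, g, hqg, hg⟩ : ∃ q : (S.mutate i).laurentRing K, Prime q ∧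
      ∃ g : (S.mutate i).laurentRing K, S.exchangePolynomial i = (q : F) * g ∧ ¬ q ∣ g := by
    rw [hf]
    by_cases h0 : ∃ k, S.mat k i ≠ 0
    · obtain ⟨l, hl⟩ := h0
      exact SeedTriple.exists_prime_factor_of_ne_zero hA' (e := fun k => S.mat k i) hl
    · rcases hK with h | ⟨⟨φ⟩⟩
      · exact absurd
          (SeedTriple.exists_mat_ne_zero_of_not_isIsolatedVertex hB (hiso h i)) h0
      · push Not at h0
        exact SeedTriple.exists_prime_factor_of_eq_zero φ hA' h0
  have hle : S.upperClusterAlgebra K ≤ (S.mutate i).laurentRing K :=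
    SeedTriple.upperClusterAlgebra_le [i]
  have hx : ∀ j : Fin n, S.var (Sum.inl j) ∈ S.upperClusterAlgebra K := fun j =>
    SeedTriple.mutations_var_mem_upperClusterAlgebra hA hB [] _
  have hx' : ∀ k, (S.mutate i).var k ∈ S.upperClusterAlgebra K := fun k =>
    SeedTriple.mutations_var_mem_upperClusterAlgebra hA hB [i] _
  let _ : Algebra (S.upperClusterAlgebra K) ((S.mutate i).laurentRing K) :=
    (Subalgebra.inclusion hle).toRingHom.toAlgebra
  have hmap : ∀ a : S.upperClusterAlgebra K,
      ((algebraMap _ ((S.mutate i).laurentRing K) a : (S.mutate i).laurentRing K) : F) = a :=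
    fun _ => rfl
  have hnoeth : IsNoetherianRing ((S.mutate i).laurentRing K) :=
    SeedTriple.isNoetherianRing_laurentRing hA'
  have hunit : ∀ k, IsUnit (⟨(S.mutate i).var k, SeedTriple.var_mem_laurentRing _ k⟩ :
      (S.mutate i).laurentRing K) := fun k =>
    IsUnit.of_mul_eq_one ⟨_, SeedTriple.inv_var_mem_laurentRing _ k⟩
      (Subtype.ext (mul_inv_cancel₀ (hA'.ne_zero k)))
  let M : Submonoid F := ((IsUnit.submonoid ((S.mutate i).laurentRing K)).comap
    (algebraMap (S.upperClusterAlgebra K) _)).map (S.upperClusterAlgebra K).val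
  have hden : ∀ b : (S.mutate i).laurentRing K, ∃ s a : S.upperClusterAlgebra K,
      IsUnit (algebraMap _ ((S.mutate i).laurentRing K) s) ∧
        b * algebraMap _ _ s = algebraMap _ _ a := fun b => by
    obtain ⟨_, ⟨s, hs, rfl⟩, hsb⟩ := SeedTriple.exists_mul_mem_of_mem_laurentRing (M := M)
      (by rintro _ ⟨s, _, rfl⟩; exact s.2) hx' (fun k => by
        rcases k with j | a
        · refine ⟨_, ⟨⟨_, hx' (Sum.inl j)⟩, hunit _, rfl⟩, ?_⟩
          rw [Subalgebra.coe_val, mul_inv_cancel₀ (hA'.ne_zero _)]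
          exact one_mem _
        · refine ⟨1, one_mem _, ?_⟩
          rw [one_mul, SeedTriple.mutate_var_of_ne _ (by simp)]
          exact SeedTriple.inv_frozen_mem_upperClusterAlgebra a) b.2
    exact ⟨s, ⟨_, hsb⟩, hs, Subtype.ext (mul_comm _ _)⟩
  obtain ⟨p, hp, hDVR, hmem, hheight, hone, hzero⟩ :=
    exists_isDiscreteValuationRing_comap
      (Subalgebra.inclusion_injective hle) hden hq
  obtain ⟨y, hy⟩ := hunit (Sum.inl i)
  refine ⟨hx, p, hp, hDVR, hheight, hone _ (g * ↑y⁻¹) ?_ ?_, fun j hj => hzero _ ?_,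
    q, hq, ⟨g, hqg, hg⟩, fun u => ?_⟩
  · rw [← mul_assoc, Units.eq_mul_inv_iff_mul_eq, hy]
    refine Subtype.ext ?_
    rw [Subalgebra.coe_mul, Subalgebra.coe_mul, hmap, ← hqg]
    exact congrArg (S.var (Sum.inl i) * ·) (SeedTriple.mutate_var_self S i)
  · rwa [Units.dvd_mul_right]
  · intro hdvd
    have h1 := hunit (Sum.inl j)
    refine hq.not_isUnit (isUnit_of_dvd_unit hdvd ?_)
    convert! h1 using 1
    refine Subtype.ext ?_
    exact (SeedTriple.mutate_var_of_ne S (by simpa using hj)).symm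
  · rw [hmem]
    exact ⟨fun ⟨c, hc⟩ => ⟨c, congrArg Subtype.val hc⟩, fun ⟨c, hc⟩ => ⟨c, Subtype.ext hc⟩⟩
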